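/- Let $G=(V,E)$ be a finite simple graph and $w=(w_e)_{e\in E}$ real edge weights. For $z\in\{-1,1\}^V$ put $\mathcal C(z)=\frac12\sum_{\{u,v\}\in E}w_{uv}(1-z_uz_v)$, let $C=\mathrm{diag}(\mathcal C(z))$ act on $(\mathbb C^2)^{\otimes V}$, let $B=\sum_{j\in V}X_j$ be the sum of the Pauli-$X$ operators, and let $|s\rangle$ be the uniform superposition of all computational basis states. The depth $p=1$ QAOA objective is $$\langle C(\gamma)\rangle=\langle\psi|C|\psi\rangle=\sum_z\mathcal C(z)\,|\psi(z)|^2,\qquad |\psi\rangle=e^{-i\frac{\pi}{8}B}e^{-i\gamma C}|s\rangle .$$ **Theorem.** Let $\mu\in\mathbb R$, $\sigma>0$ and $0<c_1\le c_2$. There is a constant $K>0$, depending only on $\mu,\sigma,c_1,c_2$, such that for every function $\nu$ with $\nu(D)=o(D\log D)$ as $D\to\infty$ and every $\epsilon>0$ there is a sequence $\delta_D\to0$ with the following property. Let $D\ge2$, let $G$ be a triangle-free $(D+1)$-regular graph with $N\ge1$ vertices and $\log N\le\nu(D)$, let the edge weights be i.i.d. $\mathcal N(\mu,\sigma^2)$,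 and let $c_1D^{-1/2}\le|\gamma|\le c_2D^{-1/2}$. Then $\langle C(\gamma)\rangle$ is integrable and $$\Pr\Big[\big|\langle C(\gamma)\rangle-\mathbb E\langle C(\gamma)\rangle\big|\ge\epsilon\,\big|\mathbb E\langle C(\gamma)\rangle\big|\Big]\le2\exp\left(-\frac{\epsilon D(1-\delta_D)}{K\log D}\right).$$ That is, for $\log N=o(D\log D)$ and $\gamma=\Theta(D^{-1/2})$ the bound $2\exp\big(-\epsilon D(1-o(1))/(K\log D)\big)$ holds with $K$ independent of $D$. -/

import Mathlib

open MeasureTheory ProbabilityTheory Filter Topology Asymptotics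
open scoped NNReal

namespace QAOA

/-- The eigenvalue `±1` of Pauli-`Z` on a computational basis state of one qubit
(`false` is `|0⟩`, `true` is `|1⟩`). -/
def spin (b : Bool) : ℝ := if b then -1 else 1

section

variable {V : Type*} [Fintype V] [DecidableEq V]

/-- The weighted MaxCut objective `𝒞(z) = ½ ∑_{ {u,v} ∈ E } w_{uv} (1 - z_u z_v)`, where the sum
runs over unordered edges and `z_u ∈ {-1, 1}` is the spin of the bit of `u`. -/
noncomputable def cutValue (G : SimpleGraph V) [DecidableRel G.Adj] (w : G.edgeSet → ℝ)
    (z : V → Bool) : ℝ :=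
  1 / 2 * ∑ e : G.edgeSet, w e * (1 - (Sym2.map (fun v => spin (z v)) e.1).mul)

/-- The phase Hamiltonian: the diagonal operator `C = diag(𝒞(z))` on `(ℂ²)^{⊗V}`, written in the
computational basis indexed by `V → Bool`. -/
noncomputable def costHamiltonian (G : SimpleGraph V) [DecidableRel G.Adj] (w : G.edgeSet → ℝ) :
    Matrix (V → Bool) (V → Bool) ℂ :=
  Matrix.diagonal fun z => (cutValue G w z : ℂ)

/-- The Pauli-`X` operator acting on the qubit `j`: it flips the bit `j`. -/
def pauliX (j : V) : Matrix (V → Bool) (V → Bool) ℂ :=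
  Matrix.of fun y z => if y = Function.update z j (!z j) then 1 else 0

/-- The transverse-field mixer `B = ∑_j X_j`. -/
def mixer (V : Type*) [Fintype V] [DecidableEq V] : Matrix (V → Bool) (V → Bool) ℂ :=
  ∑ j : V, pauliX j

/-- The uniform superposition `|s⟩ = |+⟩^{⊗V}`. -/
noncomputable def plusState (V : Type*) [Fintype V] : (V → Bool) → ℂ :=
  fun _ => ((1 / Real.sqrt (2 ^ Fintype.card V) : ℝ) : ℂ)

/-- The depth-one QAOA state `e^{-iβB} e^{-iγC} |s⟩`. -/
noncomputable def state (G : SimpleGraph V) [DecidableRel G.Adj] (w : G.edgeSet → ℝ)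
    (γ β : ℝ) : (V → Bool) → ℂ :=
  Matrix.mulVec (NormedSpace.exp ((-(Complex.I * (β : ℂ))) • mixer V))
    (Matrix.mulVec (NormedSpace.exp ((-(Complex.I * (γ : ℂ))) • costHamiltonian G w))
      (plusState V))

/-- The depth-one QAOA objective `⟨C(γ, β)⟩ = ∑_z 𝒞(z) Pr(z)`, where `Pr(z)` is the probability
of observing `z` when all qubits of the QAOA state are measured. -/
noncomputable def energy (G : SimpleGraph V) [DecidableRel G.Adj] (w : G.edgeSet → ℝ)
    (γ β : ℝ) : ℝ :=
  ∑ z : V → Bool, cutValue G w z * ‖state G w γ β z‖ ^ 2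

/-- `⟨C(γ)⟩ = ⟨C(γ, π/8)⟩`. -/
noncomputable def objective (G : SimpleGraph V) [DecidableRel G.Adj] (γ : ℝ)
    (w : G.edgeSet → ℝ) : ℝ :=
  energy G w γ (Real.pi / 8)

/-- The law of i.i.d. edge weights with distribution `N(μ, σ²)`. -/
noncomputable def gaussianWeights (G : SimpleGraph V) [DecidableRel G.Adj] (μ : ℝ) (σ : ℝ≥0) :
    Measure (G.edgeSet → ℝ) :=
  Measure.pi fun _ => gaussianReal μ (σ ^ 2)

end

end QAOA

/-! On a triangle-free graph the depth-one objective has a closed form (`objective_eq`): half the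
total weight plus a quarter of the sum over vertices u of ∑_v w_uv sin(γ w_uv) ∏_{x ≠ v} cos(γ
w_ux). It comes from the Heisenberg evolution of Z_u Z_v (`mixer_heisenberg`): of the resulting
terms only the two single bit flips survive (`sum_single_flip`, `sum_double_flip`).

Suppose all |γ w| ≤ 1. The product of cosines then decays like exp(-T/4) with T = ∑_v (γ w_uv)², so
a star sum is O(1/|γ|) whatever the degree (`abs_mul_abs_sum_star_le`). Hence moving one weight from
a to b changes the objective by at most a constant times (1 + a²) + (1 + b²)
(`abs_truncObjective_update_sub_le`). Gaussian weights give such oscillations exponential moments,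
and integrating out one coordinate at a time yields a Chernoff bound
(`measureReal_abs_sub_integral_ge_le`). The event |γ w| > 1 forces w² ≥ D/c₂²; its total effect is
controlled by `excess`, whose exponential moment is 1 plus a term exponentially small in D
(`measureReal_sum_excess_ge_le`).

Together these bound a deviation of order N√D by 3 exp(-Nη) with η > 0 independent of N and D
(`measureReal_objective_deviation_le`). By independence the mean is N(D+1)/4 times E w + E[w sin γw]
(E cos γw)^D, and the second factor is at least c/√D in absolute value for large D
(`integral_objective`, `eventually_edge_mean_ge`), so N√D is within the scale of the mean. Finally N
> D, and exp(-Dη) is eventually far below exp(-εD/log D). -/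

namespace QAOA

open scoped Matrix

/-! ### Qubit operators: Euler's formula and Heisenberg evolution under the mixer. -/

section

/-- Euler's formula for a matrix involution. -/
theorem exp_smul_of_sq_eq_one {m : Type*} [Fintype m] [DecidableEq m] (X : Matrix m m ℂ)
    (hX : X * X = 1) (t : ℂ) :
    NormedSpace.exp ((Complex.I * t) • X) = Complex.cos t • 1 + (Complex.I * Complex.sin t) • X := by
  let P : Matrix m m ℂ := (1 / 2 : ℂ) • (1 + X)
  let Q : Matrix m m ℂ := (1 / 2 : ℂ) • (1 - X)
  have hPP : P * P = P := by
    simp only [P, smul_mul_smul_comm, add_mul, mul_add, hX, one_mul, mul_one]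
    module
  have hQQ : Q * Q = Q := by
    simp only [Q, smul_mul_smul_comm, sub_mul, mul_sub, hX, one_mul, mul_one]
    module
  have hPQ : P * Q = 0 := by
    simp only [P, Q, smul_mul_smul_comm, add_mul, mul_sub, hX, one_mul, mul_one]
    module
  have hQP : Q * P = 0 := by
    simp only [P, Q, smul_mul_smul_comm, sub_mul, mul_add, hX, one_mul, mul_one]
    module
  have hadd : P + Q = 1 := by simp only [P, Q]; module
  -- `P` and `Q` are the spectral projections of `X` for the eigenvalues 1 and -1, and `f` is the
  -- resulting functional calculus: the exponential is computed componentwise in ℂ × ℂ and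
  -- transported.
  let f : (ℂ × ℂ) →+* Matrix m m ℂ :=
    { toFun := fun v => v.1 • P + v.2 • Q
      map_one' := by simpa using hadd
      map_zero' := by simp
      map_add' := fun v w => by simp only [Prod.fst_add, Prod.snd_add]; module
      map_mul' := fun v w => by
        simp [add_mul, mul_add, hPP, hQQ, hPQ, hQP, smul_smul, mul_comm] }
  have hf : Continuous f := by
    change Continuous fun v : ℂ × ℂ => v.1 • P + v.2 • Q
    fun_prop
  -- The exponential series is taken with rational coefficients, which every ring homomorphism
  -- respects.
  have h : f (NormedSpace.exp (Complex.I * t, -(Complex.I * t))) =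
      NormedSpace.exp (f (Complex.I * t, -(Complex.I * t))) := by
    rw [NormedSpace.exp_eq_tsum_rat (𝔸 := Matrix m m ℂ)]
    have hs := (NormedSpace.exp_series_hasSum_exp' (𝕂 := ℚ)
      ((Complex.I * t, -(Complex.I * t)) : ℂ × ℂ)).map f hf
    rw [← hs.tsum_eq]
    refine tsum_congr fun n => ?_
    simp only [Function.comp_apply]
    rw [map_rat_smul, map_pow]
  have h1 : f (Complex.I * t, -(Complex.I * t)) = (Complex.I * t) • X := by
    change (Complex.I * t) • P + (-(Complex.I * t)) • Q = _
    simp only [P, Q]; module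
  rw [h1] at h
  rw [← h]
  change (NormedSpace.exp (Complex.I * t, -(Complex.I * t))).1 • P +
    (NormedSpace.exp (Complex.I * t, -(Complex.I * t))).2 • Q = _
  rw [Prod.fst_exp, Prod.snd_exp, ← Complex.exp_eq_exp_ℂ]
  have e1 : Complex.exp (Complex.I * t) = Complex.cos t + Complex.I * Complex.sin t := by
    rw [mul_comm, Complex.exp_mul_I]; ring
  have e2 : Complex.exp (-(Complex.I * t)) = Complex.cos t - Complex.I * Complex.sin t := by
    rw [show -(Complex.I * t) = (-t) * Complex.I by ring, Complex.exp_mul_I, Complex.cos_neg,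
      Complex.sin_neg]; ring
  simp only [e1, e2, P, Q]
  module

end

section

variable {V : Type*} [Fintype V] [DecidableEq V]

/-- The computational basis state `z` with the bit `j` flipped. -/
def flip (j : V) (z : V → Bool) : V → Bool := Function.update z j (!z j)

omit [Fintype V] in
theorem flip_flip (j : V) (z : V → Bool) : flip j (flip j z) = z := by
  simp [flip]

omit [Fintype V] in
theorem flip_comm (j k : V) (z : V → Bool) : flip j (flip k z) = flip k (flip j z) := by
  by_cases h : j = k
  · rw [h]
  · ext i
    simp only [flip, Function.update_apply]
    grind

theorem spin_not (b : Bool) : spin (!b) = -spin b := by cases b <;> simp [spin]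

theorem spin_mul_self (b : Bool) : spin b * spin b = 1 := by cases b <;> simp [spin]

omit [Fintype V] in
theorem spin_flip_self (j : V) (z : V → Bool) : spin (flip j z j) = -spin (z j) := by
  simp [flip, spin_not]

omit [Fintype V] in
theorem spin_flip_of_ne {j k : V} (h : k ≠ j) (z : V → Bool) :
    spin (flip j z k) = spin (z k) := by
  simp [flip, h]

theorem pauliX_mulVec (j : V) (φ : (V → Bool) → ℂ) (z : V → Bool) :
    (pauliX j *ᵥ φ) z = φ (flip j z) := by
  have : ∀ y : V → Bool, (z = flip j y) ↔ (y = flip j z) := fun y =>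
    ⟨fun h => by rw [h, flip_flip], fun h => by rw [h, flip_flip]⟩
  simp only [pauliX, Matrix.mulVec, dotProduct, Matrix.of_apply]
  change ∑ y, (if z = flip j y then (1 : ℂ) else 0) * φ y = _
  simp [this]

theorem matrix_ext_mulVec {m : Type*} [Fintype m] [DecidableEq m] {A B : Matrix m m ℂ}
    (h : ∀ φ z, (A *ᵥ φ) z = (B *ᵥ φ) z) : A = B := by
  apply Matrix.toLin'.injective
  refine LinearMap.ext fun φ => funext fun z => ?_
  simp only [Matrix.toLin'_apply, h]

theorem pauliX_mul_self (j : V) : pauliX j * pauliX j = 1 :=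
  matrix_ext_mulVec fun φ z => by
    simp [← Matrix.mulVec_mulVec, pauliX_mulVec, flip_flip]

theorem pauliX_commute (j k : V) : Commute (pauliX j) (pauliX k) :=
  matrix_ext_mulVec fun φ z => by
    simp [← Matrix.mulVec_mulVec, pauliX_mulVec, flip_comm j k]

theorem pauliX_isHermitian (j : V) : (pauliX j).IsHermitian := by
  ext y z
  have : (z = flip j y) ↔ (y = flip j z) :=
    ⟨fun h => by rw [h, flip_flip], fun h => by rw [h, flip_flip]⟩
  change star (if z = flip j y then (1 : ℂ) else 0) = if y = flip j z then 1 else 0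
  simp only [this]
  split_ifs <;> simp

theorem mixer_isHermitian : (mixer V).IsHermitian := by
  simp only [mixer, Matrix.IsHermitian, Matrix.conjTranspose_sum]
  exact Finset.sum_congr rfl fun j _ => pauliX_isHermitian j

/-- The observable `Z_u Z_v`. -/
noncomputable def pauliZZ (u v : V) : Matrix (V → Bool) (V → Bool) ℂ :=
  Matrix.diagonal fun z => ((spin (z u) * spin (z v) : ℝ) : ℂ)

theorem pauliZZ_mulVec (u v : V) (φ : (V → Bool) → ℂ) (z : V → Bool) :
    (pauliZZ u v *ᵥ φ) z = ((spin (z u) * spin (z v) : ℝ) : ℂ) * φ z := by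
  simp [pauliZZ, Matrix.mulVec_diagonal]

theorem pauliZZ_mul_self (u v : V) : pauliZZ u v * pauliZZ u v = 1 :=
  matrix_ext_mulVec fun φ z => by
    simp only [← Matrix.mulVec_mulVec, pauliZZ_mulVec, Matrix.one_mulVec, ← mul_assoc,
      ← Complex.ofReal_mul]
    rw [show spin (z u) * spin (z v) * spin (z u) * spin (z v) =
      (spin (z u) * spin (z u)) * (spin (z v) * spin (z v)) by ring, spin_mul_self, spin_mul_self]
    simp

/-- Z and X anticommute on the same qubit and commute on different ones. -/
theorem pauliZZ_conj_pauliX {u v : V} (huv : u ≠ v) (j : V) :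
    pauliZZ u v * pauliX j * pauliZZ u v =
      if j = u ∨ j = v then -pauliX j else pauliX j := by
  refine matrix_ext_mulVec fun φ z => ?_
  have hs : ∀ k : V, (spin (z k) : ℂ) * spin (z k) = 1 := fun k => by
    exact_mod_cast spin_mul_self (z k)
  have hl : ((pauliZZ u v * pauliX j * pauliZZ u v) *ᵥ φ) z =
      (spin (z u) * spin (z v)) * (spin (flip j z u) * spin (flip j z v)) * φ (flip j z) := by
    simp only [← Matrix.mulVec_mulVec, pauliZZ_mulVec, pauliX_mulVec]
    push_cast; ring
  rw [hl]
  by_cases h1 : j = u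
  · subst h1
    rw [spin_flip_self, spin_flip_of_ne huv.symm]
    simp only [true_or, if_true, Matrix.neg_mulVec, Pi.neg_apply, pauliX_mulVec]
    push_cast
    linear_combination (-(spin (z v) : ℂ) * spin (z v) * φ (flip j z)) * hs j - φ (flip j z) * hs v
  by_cases h2 : j = v
  · subst h2
    rw [spin_flip_self, spin_flip_of_ne huv]
    simp only [or_true, if_true, Matrix.neg_mulVec, Pi.neg_apply, pauliX_mulVec]
    push_cast
    linear_combination (-(spin (z u) : ℂ) * spin (z u) * φ (flip j z)) * hs j - φ (flip j z) * hs u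
  · rw [spin_flip_of_ne (Ne.symm h1), spin_flip_of_ne (Ne.symm h2)]
    simp only [h1, h2, or_self, if_false, pauliX_mulVec]
    linear_combination ((spin (z v) : ℂ) * spin (z v) * φ (flip j z)) * hs u + φ (flip j z) * hs v

theorem pauliZZ_conj_mixer {u v : V} (huv : u ≠ v) :
    pauliZZ u v * mixer V * pauliZZ u v =
      mixer V - (2 : ℂ) • (pauliX u + pauliX v) := by
  simp only [mixer, Finset.mul_sum, Finset.sum_mul, pauliZZ_conj_pauliX huv]
  have : ∀ j : V, (if j = u ∨ j = v then -pauliX j else pauliX j) =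
      pauliX j - (2 : ℂ) • ((if j = u then pauliX j else 0) + (if j = v then pauliX j else 0)) := by
    intro j
    by_cases h1 : j = u
    · have h2 : j ≠ v := fun h => huv (h1 ▸ h)
      simp only [h1, true_or, if_true]
      rw [if_neg (h1 ▸ h2)]; module
    · by_cases h2 : j = v
      · simp only [h2, or_true, if_true]
        rw [if_neg huv.symm]; module
      · simp [h1, h2]
  simp only [this, Finset.sum_sub_distrib, ← Finset.smul_sum, Finset.sum_add_distrib]
  simp

theorem pauliX_commute_mixer (j : V) : Commute (pauliX j) (mixer V) :=
  Commute.sum_right _ _ _ fun k _ => pauliX_commute j k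

/-- Evolving `Z_u Z_v` in the Heisenberg picture under the mixer. -/
theorem mixer_heisenberg {u v : V} (huv : u ≠ v) (β : ℝ) :
    (NormedSpace.exp ((-(Complex.I * (β : ℂ))) • mixer V))ᴴ * pauliZZ u v *
        NormedSpace.exp ((-(Complex.I * (β : ℂ))) • mixer V) =
      (Complex.cos (2 * β) • 1 + (Complex.I * Complex.sin (2 * β)) • pauliX u) *
      (Complex.cos (2 * β) • 1 + (Complex.I * Complex.sin (2 * β)) • pauliX v) * pauliZZ u v := by
  set U := NormedSpace.exp ((-(Complex.I * (β : ℂ))) • mixer V) with hU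
  have hUH : Uᴴ = NormedSpace.exp ((Complex.I * (β : ℂ)) • mixer V) := by
    rw [hU, ← Matrix.exp_conjTranspose, Matrix.conjTranspose_smul, mixer_isHermitian.eq]
    congr 2
    simp
  have hunit : IsUnit (pauliZZ u v) :=
    IsUnit.of_mul_eq_one _ (pauliZZ_mul_self u v)
  have hinv : (pauliZZ u v)⁻¹ = pauliZZ u v := Matrix.inv_eq_right_inv (pauliZZ_mul_self u v)
  have h1 : pauliZZ u v * U * pauliZZ u v = NormedSpace.exp
      ((-(Complex.I * (β : ℂ))) • (mixer V - (2 : ℂ) • (pauliX u + pauliX v))) := by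
    have h := Matrix.exp_conj (pauliZZ u v) ((-(Complex.I * (β : ℂ))) • mixer V) hunit
    rw [hinv] at h
    rw [← h, Matrix.mul_smul, Matrix.smul_mul, pauliZZ_conj_mixer huv]
  -- Inserting (Z_u Z_v)² = 1 isolates the conjugated exponential. All X operators commute, so B
  -- cancels between the two exponentials and only exp(2iβ(X_u + X_v)) remains.
  have h2 : Uᴴ * pauliZZ u v * U = Uᴴ * (pauliZZ u v * U * pauliZZ u v) * pauliZZ u v := by
    simp only [mul_assoc, pauliZZ_mul_self, mul_one]
  rw [h2, h1, hUH, ← exp_smul_of_sq_eq_one _ (pauliX_mul_self u),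
    ← exp_smul_of_sq_eq_one _ (pauliX_mul_self v), ← Matrix.exp_add_of_commute,
    ← Matrix.exp_add_of_commute]
  · congr 2
    module
  · exact ((pauliX_commute u v).smul_left _).smul_right _
  · refine (Commute.smul_left ?_ _).smul_right _
    refine (Commute.refl _).sub_right (Commute.smul_right ?_ _)
    exact ((pauliX_commute_mixer u).symm).add_right (pauliX_commute_mixer v).symm

theorem mixer_exp_unitary (β : ℝ) :
    (NormedSpace.exp ((-(Complex.I * (β : ℂ))) • mixer V))ᴴ *
        NormedSpace.exp ((-(Complex.I * (β : ℂ))) • mixer V) = 1 := by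
  rw [← Matrix.exp_conjTranspose, Matrix.conjTranspose_smul, mixer_isHermitian.eq,
    ← Matrix.exp_add_of_commute]
  · rw [← add_smul]; simp
  · exact ((Commute.refl _).smul_left _).smul_right _

end

/-! ### Interference sums over bit strings. -/

section

variable {V : Type*} [Fintype V] [DecidableEq V]

/-- The symmetric weight matrix of a weighted graph. -/
noncomputable def edgeWeight (G : SimpleGraph V) [DecidableRel G.Adj] (w : G.edgeSet → ℝ)
    (u v : V) : ℝ :=
  if h : G.Adj u v then w ⟨s(u, v), h⟩ else 0

/-- For the weights `y` of the edges at a vertex: `∑_v y_v sin(γ y_v) ∏_{x ≠ v} cos(γ y_x)`. -/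
noncomputable def starEnergy (γ : ℝ) (y : V → ℝ) : ℝ :=
  ∑ v, y v * Real.sin (γ * y v) * ∏ x ∈ Finset.univ.erase v, Real.cos (γ * y x)

variable (G : SimpleGraph V) [DecidableRel G.Adj]

omit [Fintype V] [DecidableEq V] in
theorem edgeWeight_symm (w : G.edgeSet → ℝ) (u v : V) :
    edgeWeight G w u v = edgeWeight G w v u := by
  unfold edgeWeight
  by_cases h : G.Adj u v
  · rw [dif_pos h, dif_pos h.symm]
    congr 2
    exact Sym2.eq_swap
  · rw [dif_neg h, dif_neg (fun h' => h h'.symm)]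

omit [Fintype V] [DecidableEq V] in
theorem edgeWeight_of_not_adj (w : G.edgeSet → ℝ) {u v : V} (h : ¬ G.Adj u v) :
    edgeWeight G w u v = 0 := dif_neg h

omit [Fintype V] [DecidableEq V] in
theorem edgeWeight_self (w : G.edgeSet → ℝ) (u : V) : edgeWeight G w u u = 0 :=
  edgeWeight_of_not_adj G w (G.loopless.irrefl u)

/-- Summing over ordered pairs of adjacent vertices counts every edge twice. -/
theorem sum_sum_edgeWeight (φ : G.edgeSet → ℝ) :
    ∑ u, ∑ v, edgeWeight G φ u v = 2 * ∑ e, φ e := by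
  classical
  let h : Sym2 V → ℝ := fun s => if hs : s ∈ G.edgeSet then φ ⟨s, hs⟩ else 0
  have h1 : ∀ u v, edgeWeight G φ u v = h s(u, v) := fun u v => by
    simp only [edgeWeight, h, SimpleGraph.mem_edgeSet]
  have h2 : ∑ u, ∑ v, edgeWeight G φ u v = ∑ p : V × V, h s(p.1, p.2) := by
    rw [Fintype.sum_prod_type]
    simp only [h1]
  have h3 : ∀ s : Sym2 V, ∑ p : V × V with s(p.1, p.2) = s, h s(p.1, p.2) = 2 * h s := by
    intro s
    induction s using Sym2.ind with
    | _ a b =>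
      by_cases hab : a = b
      · subst hab
        have h0 : h s(a, a) = 0 := by simp [h]
        rw [h0, mul_zero]
        refine Finset.sum_eq_zero fun p hp => ?_
        rw [(Finset.mem_filter.1 hp).2, h0]
      · have : (Finset.univ.filter fun p : V × V => s(p.1, p.2) = s(a, b)) =
            {(a, b), (b, a)} := by
          ext ⟨x, y⟩
          simp
        rw [this, Finset.sum_pair (by simp [hab]), Sym2.eq_swap (a := b)]
        ring
  rw [h2, ← Finset.sum_fiberwise (s := Finset.univ) (g := fun p : V × V => s(p.1, p.2))]
  simp only [h3]
  rw [← Finset.mul_sum]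
  congr 1
  refine (Fintype.sum_of_injective Subtype.val Subtype.val_injective φ h (fun s hs => ?_)
    fun e => ?_).symm
  · refine dif_neg fun hs' => hs ⟨⟨s, hs'⟩, rfl⟩
  · simp [h]

theorem cutValue_eq (w : G.edgeSet → ℝ) (z : V → Bool) :
    cutValue G w z = 1 / 4 * ∑ u, ∑ v, edgeWeight G w u v * (1 - spin (z u) * spin (z v)) := by
  have h := sum_sum_edgeWeight G
    (fun e => w e * (1 - (Sym2.map (fun v => spin (z v)) e.1).mul))
  have h2 : ∀ u v, edgeWeight G (fun e => w e * (1 - (Sym2.map (fun v => spin (z v)) e.1).mul)) u v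
      = edgeWeight G w u v * (1 - spin (z u) * spin (z v)) := by
    intro u v
    unfold edgeWeight
    split_ifs <;> simp
  simp only [h2] at h
  rw [h, cutValue]
  ring

/-- Only terms containing u change, each by -2 w z_u z_x; each edge occurs as two ordered pairs,
which cancels the prefactor 1/4. -/
theorem cutValue_sub_flip (w : G.edgeSet → ℝ) (z : V → Bool) (u : V) :
    cutValue G w z - cutValue G w (flip u z) =
      -∑ x, edgeWeight G w u x * (spin (z u) * spin (z x)) := by
  have hs : ∀ a, spin (flip u z a) = spin (z a) * (1 - 2 * if a = u then 1 else 0) := by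
    intro a
    by_cases h : a = u
    · subst h; rw [spin_flip_self]; simp; ring
    · rw [spin_flip_of_ne h]; simp [h]
  have key : ∀ a b, edgeWeight G w a b * (1 - spin (z a) * spin (z b)) -
      edgeWeight G w a b * (1 - spin (flip u z a) * spin (flip u z b)) =
      (if a = u then -2 * (edgeWeight G w u b * (spin (z u) * spin (z b))) else 0) +
      (if b = u then -2 * (edgeWeight G w u a * (spin (z u) * spin (z a))) else 0) := by
    intro a b
    rw [hs, hs]
    by_cases ha : a = u
    · by_cases hb : b = u
      · subst ha; subst hb; simp [edgeWeight_self]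
      · subst ha; simp only [if_true, hb, if_false]; ring
    · by_cases hb : b = u
      · subst hb; simp only [if_true, ha, if_false]; rw [edgeWeight_symm G w b a]; ring
      · simp only [ha, hb, if_false]; ring
  rw [cutValue_eq, cutValue_eq, ← mul_sub, ← Finset.sum_sub_distrib]
  simp only [← Finset.sum_sub_distrib, key, Finset.sum_add_distrib]
  rw [Finset.sum_comm]
  simp only [Finset.sum_ite_eq', Finset.mem_univ, if_true, ← Finset.mul_sum]
  ring

omit [Fintype V] [DecidableEq V] in
theorem spin_xor (a b : Bool) : spin (a ^^ b) = spin a * spin b := by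
  cases a <;> cases b <;> simp [spin]

/-- Flipping u is a sign-reversing involution. -/
theorem sum_spin_mul_spin {u v : V} (huv : u ≠ v) :
    ∑ z : V → Bool, spin (z u) * spin (z v) = 0 := by
  have hT : Function.Involutive (flip u : (V → Bool) → V → Bool) := flip_flip u
  have := Equiv.sum_comp hT.toPerm fun z : V → Bool => spin (z u) * spin (z v)
  simp only [Function.Involutive.coe_toPerm, spin_flip_self, spin_flip_of_ne huv.symm, neg_mul,
    Finset.sum_neg_distrib] at this
  linarith

/-- The interference term of a single bit flip. -/
theorem sum_single_flip (w : G.edgeSet → ℝ) (γ : ℝ) {u v : V} (huv : u ≠ v) :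
    ∑ z : V → Bool, ((spin (z u) * spin (z v) : ℝ) : ℂ) *
        Complex.exp (Complex.I * (γ * (cutValue G w z - cutValue G w (flip u z) : ℝ))) =
      2 ^ Fintype.card V * (-Complex.I * ((Real.sin (γ * edgeWeight G w u v) *
        ∏ x ∈ Finset.univ.erase v, Real.cos (γ * edgeWeight G w u x) : ℝ) : ℂ)) := by
  -- Recording every other bit relative to the bit of u turns z_u z_x into a single spin, so the sum
  -- factors over vertices. The factor at u itself is harmless because w_uu = 0.
  let T : (V → Bool) → V → Bool := fun z x => if x = u then z u else z x ^^ z u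
  have hT : Function.Involutive T := by
    intro z
    ext x
    by_cases h : x = u <;> simp [T, h]
  let h : V → Bool → ℂ := fun x b => (if x = v then (spin b : ℂ) else 1) *
    Complex.exp (-(Complex.I * (γ * edgeWeight G w u x * spin b)))
  have hf : ∀ z, ((spin (T z u) * spin (T z v) : ℝ) : ℂ) *
      Complex.exp (Complex.I * (γ * (cutValue G w (T z) - cutValue G w (flip u (T z)) : ℝ))) =
      ∏ x, h x (z x) := by
    intro z
    simp only [h, Finset.prod_mul_distrib]
    rw [Finset.prod_ite_eq' Finset.univ v, if_pos (Finset.mem_univ _), ← Complex.exp_sum,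
      cutValue_sub_flip]
    have h1 : spin (T z u) * spin (T z v) = spin (z v) := by
      simp only [T, if_true, if_neg huv.symm, spin_xor]
      linear_combination spin (z v) * spin_mul_self (z u)
    have h2 : ∀ x, edgeWeight G w u x * (spin (T z u) * spin (T z x)) =
        edgeWeight G w u x * spin (z x) := by
      intro x
      by_cases hx : x = u
      · subst hx; simp [edgeWeight_self]
      · simp only [T, if_true, if_neg hx, spin_xor]
        linear_combination edgeWeight G w u x * spin (z x) * spin_mul_self (z u)
    rw [h1]
    simp only [h2]
    congr 2
    push_cast
    simp only [mul_neg, Finset.mul_sum, ← Finset.sum_neg_distrib]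
    exact Finset.sum_congr rfl fun x _ => by ring
  rw [← Equiv.sum_comp hT.toPerm]
  simp only [Function.Involutive.coe_toPerm, hf]
  have h3 : ∑ z : V → Bool, ∏ x, h x (z x) = ∏ x, ∑ b, h x b := by
    rw [Finset.prod_univ_sum, Fintype.piFinset_univ]
  have h4 : ∀ x, ∑ b, h x b = 2 * if x = v then -Complex.I * Complex.sin (γ * edgeWeight G w u x)
      else Complex.cos (γ * edgeWeight G w u x) := by
    intro x
    have e1 : Complex.exp (-(Complex.I * (γ * edgeWeight G w u x * (spin false : ℝ)))) =
        Complex.cos (γ * edgeWeight G w u x) - Complex.sin (γ * edgeWeight G w u x) * Complex.I := by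
      rw [show -(Complex.I * (γ * edgeWeight G w u x * (spin false : ℝ))) =
        (-(γ * edgeWeight G w u x : ℂ)) * Complex.I by simp [spin]; ring, Complex.exp_mul_I]
      simp; ring
    have e2 : Complex.exp (-(Complex.I * (γ * edgeWeight G w u x * (spin true : ℝ)))) =
        Complex.cos (γ * edgeWeight G w u x) + Complex.sin (γ * edgeWeight G w u x) * Complex.I := by
      rw [show -(Complex.I * (γ * edgeWeight G w u x * (spin true : ℝ))) =
        (γ * edgeWeight G w u x : ℂ) * Complex.I by simp [spin]; ring, Complex.exp_mul_I]
    simp only [h, Fintype.sum_bool, e1, e2]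
    by_cases hx : x = v
    · simp [hx, spin]; ring
    · simp [hx]; ring
  rw [h3]
  simp only [h4, Finset.prod_mul_distrib, Finset.prod_const, Finset.card_univ]
  congr 1
  rw [← Finset.mul_prod_erase _ _ (Finset.mem_univ v), if_pos rfl]
  push_cast
  rw [← mul_assoc]
  congr 1
  exact Finset.prod_congr rfl fun x hx => if_neg (Finset.ne_of_mem_erase hx)

/-- The interference term of a double bit flip vanishes on a triangle-free graph. -/
theorem sum_double_flip (hG : G.CliqueFree 3) (w : G.edgeSet → ℝ) (γ : ℝ) {u v : V}
    (huv : G.Adj u v) :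
    ∑ z : V → Bool, ((spin (z u) * spin (z v) : ℝ) : ℂ) *
      Complex.exp (Complex.I * (γ * (cutValue G w z - cutValue G w (flip u (flip v z)) : ℝ))) =
      0 := by
  have hne : u ≠ v := huv.ne
  -- Flipping both endpoints leaves the edge uv unchanged, so its two contributions cancel.
  have hdiff : ∀ z, cutValue G w z - cutValue G w (flip u (flip v z)) =
      -∑ x, ((if x = u then 0 else edgeWeight G w v x * (spin (z v) * spin (z x))) +
        (if x = v then 0 else edgeWeight G w u x * (spin (z u) * spin (z x)))) := by
    intro z
    have h1 := cutValue_sub_flip G w z v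
    have h2 := cutValue_sub_flip G w (flip v z) u
    have h3 : cutValue G w z - cutValue G w (flip u (flip v z)) =
      -∑ x, (edgeWeight G w v x * (spin (z v) * spin (z x)) +
        edgeWeight G w u x * (spin (flip v z u) * spin (flip v z x))) := by
      rw [Finset.sum_add_distrib]; linarith
    have h4 : ∀ x, edgeWeight G w v x * (spin (z v) * spin (z x)) +
        edgeWeight G w u x * (spin (flip v z u) * spin (flip v z x)) =
        ((if x = u then 0 else edgeWeight G w v x * (spin (z v) * spin (z x))) +
        (if x = v then 0 else edgeWeight G w u x * (spin (z u) * spin (z x)))) +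
        ((if x = u then edgeWeight G w v u * (spin (z v) * spin (z u)) else 0) +
        (if x = v then -(edgeWeight G w u v * (spin (z u) * spin (z v))) else 0)) := by
      intro x
      rw [spin_flip_of_ne hne]
      by_cases hx : x = v
      · subst hx; rw [spin_flip_self]; simp only [if_true, if_neg hne.symm]; ring
      · rw [spin_flip_of_ne hx]
        by_cases hx' : x = u
        · subst hx'; simp only [if_true, hx, if_false]; ring
        · simp [hx, hx']
    rw [h3]
    have h5 : ∑ x, ((if x = u then edgeWeight G w v u * (spin (z v) * spin (z u)) else 0) +
        (if x = v then -(edgeWeight G w u v * (spin (z u) * spin (z v))) else 0)) = 0 := by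
      rw [Finset.sum_add_distrib, Finset.sum_ite_eq', Finset.sum_ite_eq', if_pos (Finset.mem_univ _),
        if_pos (Finset.mem_univ _), edgeWeight_symm G w v u]
      ring
    rw [Finset.sum_congr rfl fun x _ => h4 x, Finset.sum_add_distrib, h5, add_zero]
  -- `T` flips u and all its neighbours except v. Without triangles no neighbour of v other than u
  -- is flipped, so the cost difference is invariant while z_u z_v changes sign; the sum equals its
  -- own negative.
  let T : (V → Bool) → V → Bool := fun z x => if x = u ∨ (G.Adj u x ∧ x ≠ v) then !z x else z x
  have hT : Function.Involutive T := by
    intro z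
    ext x
    by_cases h : x = u ∨ (G.Adj u x ∧ x ≠ v) <;> simp [T, h]
  have hTu : ∀ z, spin (T z u) = -spin (z u) := fun z => by simp [T, spin_not]
  have hTv : ∀ z, spin (T z v) = spin (z v) := fun z => by simp [T, hne.symm]
  have hinv : ∀ z, cutValue G w (T z) - cutValue G w (flip u (flip v (T z))) =
      cutValue G w z - cutValue G w (flip u (flip v z)) := by
    intro z
    rw [hdiff, hdiff]
    congr 1
    refine Finset.sum_congr rfl fun x _ => ?_
    congr 1
    · by_cases hx : x = u
      · simp [hx]
      · rw [if_neg hx, if_neg hx]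
        by_cases hvx : G.Adj v x
        · have hux : ¬ G.Adj u x := fun h => by
            apply hG {u, v, x}
            rw [SimpleGraph.is3Clique_triple_iff]
            exact ⟨huv, h, hvx⟩
          have : spin (T z x) = spin (z x) := by simp [T, hx, hux]
          rw [this, hTv]
        · rw [edgeWeight_of_not_adj G w hvx]; simp
    · by_cases hx : x = v
      · simp [hx]
      · rw [if_neg hx, if_neg hx]
        by_cases hux : G.Adj u x
        · have : spin (T z x) = -spin (z x) := by simp [T, hx, hux, spin_not]
          rw [this, hTu]; ring
        · rw [edgeWeight_of_not_adj G w hux]; simp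
  have h := Equiv.sum_comp hT.toPerm fun z : V → Bool => ((spin (z u) * spin (z v) : ℝ) : ℂ) *
      Complex.exp (Complex.I * (γ * (cutValue G w z - cutValue G w (flip u (flip v z)) : ℝ)))
  simp only [Function.Involutive.coe_toPerm, hinv, hTu, hTv, neg_mul, Complex.ofReal_neg,
    Finset.sum_neg_distrib] at h
  exact self_eq_neg.1 h.symm

end

/-! ### The closed formula for the objective. -/

section

variable {V : Type*} [Fintype V] [DecidableEq V] (G : SimpleGraph V) [DecidableRel G.Adj]

/-- The state after the phase operator. -/
noncomputable def phaseState (w : G.edgeSet → ℝ) (γ : ℝ) : (V → Bool) → ℂ :=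
  NormedSpace.exp ((-(Complex.I * (γ : ℂ))) • costHamiltonian G w) *ᵥ plusState V

theorem phaseState_apply (w : G.edgeSet → ℝ) (γ : ℝ) (z : V → Bool) :
    phaseState G w γ z = Complex.exp (-(Complex.I * (γ * cutValue G w z))) *
      ((1 / Real.sqrt (2 ^ Fintype.card V) : ℝ) : ℂ) := by
  rw [phaseState, costHamiltonian, ← Matrix.diagonal_smul, Matrix.exp_diagonal,
    Matrix.mulVec_diagonal, Pi.coe_exp, ← Complex.exp_eq_exp_ℂ, plusState]
  congr 2
  simp only [Pi.smul_apply, smul_eq_mul]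
  ring

/-- The amplitudes have equal modulus, so every matrix element needed below is a phase determined by
a difference of costs. -/
theorem star_phaseState_mul (w : G.edgeSet → ℝ) (γ : ℝ) (z z' : V → Bool) :
    star (phaseState G w γ z) * phaseState G w γ z' =
      (2 ^ Fintype.card V)⁻¹ *
        Complex.exp (Complex.I * (γ * (cutValue G w z - cutValue G w z' : ℝ))) := by
  have h : (((1 / Real.sqrt (2 ^ Fintype.card V) : ℝ) : ℂ)) *
      ((1 / Real.sqrt (2 ^ Fintype.card V) : ℝ) : ℂ) = (2 ^ Fintype.card V)⁻¹ := by
    rw [← Complex.ofReal_mul, div_mul_div_comm, Real.mul_self_sqrt (by positivity)]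
    push_cast
    simp
  have h2 : star (phaseState G w γ z) = Complex.exp (Complex.I * (γ * cutValue G w z)) *
      ((1 / Real.sqrt (2 ^ Fintype.card V) : ℝ) : ℂ) := by
    rw [phaseState_apply, star_mul']
    simp only [Complex.star_def]
    rw [Complex.conj_ofReal, ← Complex.exp_conj]
    simp
  rw [h2, phaseState_apply, ← h]
  have h3 : Complex.exp (Complex.I * (γ * (cutValue G w z - cutValue G w z' : ℝ))) =
      Complex.exp (Complex.I * (γ * cutValue G w z)) *
      Complex.exp (-(Complex.I * (γ * cutValue G w z'))) := by
    rw [← Complex.exp_add]; congr 1; push_cast; ring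
  rw [h3]
  ring

theorem state_eq (w : G.edgeSet → ℝ) (γ β : ℝ) :
    state G w γ β = NormedSpace.exp ((-(Complex.I * (β : ℂ))) • mixer V) *ᵥ phaseState G w γ := rfl

theorem star_mulVec_dotProduct {m : Type*} [Fintype m] [DecidableEq m] (U A : Matrix m m ℂ)
    (φ : m → ℂ) : star (U *ᵥ φ) ⬝ᵥ (A *ᵥ (U *ᵥ φ)) = star φ ⬝ᵥ ((Uᴴ * A * U) *ᵥ φ) := by
  rw [Matrix.star_mulVec, ← Matrix.dotProduct_mulVec, Matrix.mulVec_mulVec, Matrix.mulVec_mulVec,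
    mul_assoc]

theorem sum_norm_state_sq (w : G.edgeSet → ℝ) (γ β : ℝ) :
    ∑ z, ‖state G w γ β z‖ ^ 2 = 1 := by
  have h := star_mulVec_dotProduct (NormedSpace.exp ((-(Complex.I * (β : ℂ))) • mixer V)) 1
    (phaseState G w γ)
  rw [mul_one, mixer_exp_unitary, ← state_eq, Matrix.one_mulVec, Matrix.one_mulVec] at h
  have h1 : star (state G w γ β) ⬝ᵥ state G w γ β = ((∑ z, ‖state G w γ β z‖ ^ 2 : ℝ) : ℂ) := by
    simp only [dotProduct, Pi.star_apply, Complex.star_def, Complex.ofReal_sum]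
    exact Finset.sum_congr rfl fun z _ => by rw [Complex.conj_mul']; push_cast; rfl
  have h2 : star (phaseState G w γ) ⬝ᵥ phaseState G w γ = 1 := by
    simp only [dotProduct, Pi.star_apply, star_phaseState_mul]
    simp
  rw [h1, h2] at h
  exact_mod_cast h

/-- The factor `∏_{x ≠ v} cos (γ w_{ux})`. -/
noncomputable def cosProd (γ : ℝ) (w : G.edgeSet → ℝ) (u v : V) : ℝ :=
  ∏ x ∈ Finset.univ.erase v, Real.cos (γ * edgeWeight G w u x)

/-- The correlation `⟨Z_u Z_v⟩` across an edge of a triangle-free graph. -/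
theorem sum_spin_mul_norm_state_sq (hG : G.CliqueFree 3) (w : G.edgeSet → ℝ) (γ : ℝ) {u v : V}
    (huv : G.Adj u v) :
    ∑ z, spin (z u) * spin (z v) * ‖state G w γ (Real.pi / 8) z‖ ^ 2 =
      -(1 / 2) * Real.sin (γ * edgeWeight G w u v) * (cosProd G γ w u v + cosProd G γ w v u) := by
  have hne := huv.ne
  have h := star_mulVec_dotProduct
    (NormedSpace.exp ((-(Complex.I * ((Real.pi / 8 : ℝ) : ℂ))) • mixer V)) (pauliZZ u v)
    (phaseState G w γ)
  rw [mixer_heisenberg hne, ← state_eq] at h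
  have h1 : star (state G w γ (Real.pi / 8)) ⬝ᵥ (pauliZZ u v *ᵥ state G w γ (Real.pi / 8)) =
      ((∑ z, spin (z u) * spin (z v) * ‖state G w γ (Real.pi / 8) z‖ ^ 2 : ℝ) : ℂ) := by
    simp only [dotProduct, Pi.star_apply, Complex.star_def, Complex.ofReal_sum, pauliZZ_mulVec]
    refine Finset.sum_congr rfl fun z _ => ?_
    rw [mul_left_comm, Complex.conj_mul']; push_cast; rfl
  -- At β = π/8 the doubled angle is π/4, where cosine and sine agree: all four terms of the evolved
  -- observable carry the weight r² = 1/2, up to powers of i.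
  have hang : (2 * ((Real.pi / 8 : ℝ) : ℂ)) = ((Real.pi / 4 : ℝ) : ℂ) := by push_cast; ring
  rw [h1, hang, ← Complex.ofReal_cos, ← Complex.ofReal_sin, Real.cos_pi_div_four,
    Real.sin_pi_div_four] at h
  set r : ℂ := ((Real.sqrt 2 / 2 : ℝ) : ℂ) with hr
  have hrr : r * r = 1 / 2 := by
    rw [hr, ← Complex.ofReal_mul, div_mul_div_comm, Real.mul_self_sqrt (by norm_num)]
    norm_num
  set E : (V → Bool) → ℂ := fun z => ((spin (z u) * spin (z v) : ℝ) : ℂ) with hE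
  have hEu : ∀ z, E (flip u z) = -E z := fun z => by
    simp only [hE, spin_flip_self, spin_flip_of_ne hne.symm]; push_cast; ring
  have hEv : ∀ z, E (flip v z) = -E z := fun z => by
    simp only [hE, spin_flip_self, spin_flip_of_ne hne]; push_cast; ring
  set φ := phaseState G w γ with hφ
  have hterm : ∀ z, star (φ z) * ((((r • (1 : Matrix (V → Bool) (V → Bool) ℂ) +
      (Complex.I * r) • pauliX u) * (r • 1 + (Complex.I * r) • pauliX v) * pauliZZ u v) *ᵥ φ) z) =
      (1 / 2) * (E z * (star (φ z) * φ z) - Complex.I * (E z * (star (φ z) * φ (flip v z)))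
        - Complex.I * (E z * (star (φ z) * φ (flip u z)))
        - E z * (star (φ z) * φ (flip u (flip v z)))) := by
    intro z
    simp only [← Matrix.mulVec_mulVec, Matrix.add_mulVec, Matrix.smul_mulVec, Matrix.one_mulVec,
      Pi.add_apply, Pi.smul_apply, smul_eq_mul, pauliX_mulVec, pauliZZ_mulVec]
    change star (φ z) * (r * (r * (E z * φ z) + Complex.I * r * (E (flip v z) * φ (flip v z))) +
      Complex.I * r * (r * (E (flip u z) * φ (flip u z)) +
        Complex.I * r * (E (flip v (flip u z)) * φ (flip v (flip u z))))) = _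
    rw [hEv, hEv, hEu, flip_comm v u]
    have hI : Complex.I * Complex.I = -1 := Complex.I_mul_I
    linear_combination (star (φ z) * ((E z * φ z) - Complex.I * (E z * φ (flip v z))
        - Complex.I * (E z * φ (flip u z)) - E z * φ (flip u (flip v z)))) * hrr +
        (star (φ z) * r * r * E z * φ (flip u (flip v z))) * hI
  have hpow : ((2 : ℂ) ^ Fintype.card V) ≠ 0 := pow_ne_zero _ two_ne_zero
  have s0 : ∑ z, E z * (star (φ z) * φ z) = 0 := by
    have : ∀ z, E z * (star (φ z) * φ z) = (2 ^ Fintype.card V)⁻¹ * E z := fun z => by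
      rw [hφ, star_phaseState_mul]; simp [mul_comm]
    simp only [this, ← Finset.mul_sum]
    have h0 := sum_spin_mul_spin hne
    have : ∑ z, E z = 0 := by
      simp only [hE, ← Complex.ofReal_sum]; rw [h0]; simp
    rw [this, mul_zero]
  have s1 : ∑ z, E z * (star (φ z) * φ (flip u z)) = -Complex.I *
      ((Real.sin (γ * edgeWeight G w u v) * cosProd G γ w u v : ℝ) : ℂ) := by
    have : ∀ z, E z * (star (φ z) * φ (flip u z)) = (2 ^ Fintype.card V)⁻¹ * (E z *
        Complex.exp (Complex.I * (γ * (cutValue G w z - cutValue G w (flip u z) : ℝ)))) :=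
      fun z => by rw [hφ, star_phaseState_mul]; ring
    simp only [this, ← Finset.mul_sum]
    rw [sum_single_flip G w γ hne, inv_mul_cancel_left₀ hpow, cosProd]
  have s2 : ∑ z, E z * (star (φ z) * φ (flip v z)) = -Complex.I *
      ((Real.sin (γ * edgeWeight G w u v) * cosProd G γ w v u : ℝ) : ℂ) := by
    have : ∀ z, E z * (star (φ z) * φ (flip v z)) = (2 ^ Fintype.card V)⁻¹ *
        (((spin (z v) * spin (z u) : ℝ) : ℂ) *
        Complex.exp (Complex.I * (γ * (cutValue G w z - cutValue G w (flip v z) : ℝ)))) :=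
      fun z => by rw [hφ, star_phaseState_mul, hE, mul_comm (spin (z v))]; ring
    simp only [this, ← Finset.mul_sum]
    rw [sum_single_flip G w γ hne.symm, inv_mul_cancel_left₀ hpow, cosProd, edgeWeight_symm G w v u]
  have s3 : ∑ z, E z * (star (φ z) * φ (flip u (flip v z))) = 0 := by
    have : ∀ z, E z * (star (φ z) * φ (flip u (flip v z))) = (2 ^ Fintype.card V)⁻¹ * (E z *
        Complex.exp (Complex.I * (γ * (cutValue G w z - cutValue G w (flip u (flip v z)) : ℝ)))) :=
      fun z => by rw [hφ, star_phaseState_mul]; ring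
    simp only [this, ← Finset.mul_sum]
    rw [sum_double_flip G hG w γ huv, mul_zero]
  have hsum : ((∑ z, spin (z u) * spin (z v) * ‖state G w γ (Real.pi / 8) z‖ ^ 2 : ℝ) : ℂ) =
      ((-(1 / 2) * Real.sin (γ * edgeWeight G w u v) *
        (cosProd G γ w u v + cosProd G γ w v u) : ℝ) : ℂ) := by
    rw [h]
    simp only [dotProduct, Pi.star_apply, hterm]
    rw [← Finset.mul_sum, Finset.sum_sub_distrib, Finset.sum_sub_distrib, Finset.sum_sub_distrib,
      ← Finset.mul_sum, ← Finset.mul_sum, s0, s1, s2, s3]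
    push_cast
    linear_combination (1 / 2 * (Complex.sin (γ * edgeWeight G w u v) *
      (cosProd G γ w u v + cosProd G γ w v u))) * Complex.I_mul_I
  exact_mod_cast hsum

/-- The depth-one QAOA objective on a triangle-free graph. -/
theorem objective_eq (hG : G.CliqueFree 3) (γ : ℝ) (w : G.edgeSet → ℝ) :
    objective G γ w = 1 / 2 * ∑ e, w e + 1 / 4 * ∑ u, starEnergy γ (edgeWeight G w u) := by
  set p : (V → Bool) → ℝ := fun z => ‖state G w γ (Real.pi / 8) z‖ ^ 2 with hp
  have h1 : objective G γ w = 1 / 4 * ∑ u, ∑ v, edgeWeight G w u v *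
      (∑ z, p z - ∑ z, spin (z u) * spin (z v) * p z) := by
    simp only [objective, energy, cutValue_eq]
    change ∑ z, (1 / 4 * ∑ u, ∑ v, edgeWeight G w u v * (1 - spin (z u) * spin (z v))) * p z = _
    simp only [mul_assoc, ← Finset.mul_sum, Finset.sum_mul, ← Finset.sum_sub_distrib]
    rw [Finset.sum_comm]
    congr 1
    refine Finset.sum_congr rfl fun u _ => ?_
    rw [Finset.sum_comm]
    refine Finset.sum_congr rfl fun v _ => ?_
    rw [Finset.mul_sum]
    exact Finset.sum_congr rfl fun z _ => by ring
  have h2 : ∀ u v, edgeWeight G w u v * (∑ z, p z - ∑ z, spin (z u) * spin (z v) * p z) =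
      edgeWeight G w u v +
      (1 / 2 * (edgeWeight G w u v * Real.sin (γ * edgeWeight G w u v) * cosProd G γ w u v) +
      1 / 2 * (edgeWeight G w v u * Real.sin (γ * edgeWeight G w v u) * cosProd G γ w v u)) := by
    intro u v
    by_cases huv : G.Adj u v
    · simp only [hp]
      rw [sum_norm_state_sq, sum_spin_mul_norm_state_sq G hG w γ huv, edgeWeight_symm G w v u]
      ring
    · simp [edgeWeight_of_not_adj G w huv, edgeWeight_symm G w v u]
  rw [h1]
  simp only [h2, Finset.sum_add_distrib, ← Finset.mul_sum, sum_sum_edgeWeight]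
  rw [Finset.sum_comm (f := fun u v => edgeWeight G w v u * _ * _)]
  simp only [starEnergy, cosProd]
  ring

end

/-! ### Truncated weights and the influence of a single edge. -/

/-- Truncation of a weight at `|γ|⁻¹`. -/
noncomputable def trunc (γ x : ℝ) : ℝ := if |γ * x| ≤ 1 then x else 0

/-- The square of the part of a weight removed by truncation. -/
noncomputable def excess (γ x : ℝ) : ℝ := if |γ * x| ≤ 1 then 0 else x ^ 2

theorem trunc_zero (γ : ℝ) : trunc γ 0 = 0 := by simp [trunc]

theorem excess_nonneg (γ x : ℝ) : 0 ≤ excess γ x := by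
  unfold excess; split_ifs <;> positivity

theorem abs_mul_trunc_le (γ x : ℝ) : |γ * trunc γ x| ≤ 1 := by
  unfold trunc; split_ifs with h
  · exact h
  · simp

theorem trunc_sq_le (γ x : ℝ) : trunc γ x ^ 2 ≤ x ^ 2 := by
  unfold trunc; split_ifs
  · exact le_rfl
  · simpa using sq_nonneg x

theorem cos_le_exp_neg_sq {x : ℝ} (hx : |x| ≤ 1) : Real.cos x ≤ Real.exp (-(x ^ 2 / 4)) := by
  have h1 := (abs_le.1 (Real.cos_bound hx)).2
  have h2 : |x| ^ 4 ≤ x ^ 2 := by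
    have : |x| ^ 4 = x ^ 2 * x ^ 2 := by rw [← sq_abs x]; ring
    rw [this]
    have h3 : x ^ 2 ≤ 1 := by rw [← sq_abs]; exact pow_le_one₀ (abs_nonneg _) hx
    nlinarith [sq_nonneg x]
  have h3 := Real.add_one_le_exp (-(x ^ 2 / 4))
  nlinarith [sq_nonneg x]

theorem cos_nonneg_of_abs_le_one {x : ℝ} (hx : |x| ≤ 1) : 0 ≤ Real.cos x :=
  Real.cos_nonneg_of_neg_pi_div_two_le_of_le
    (by linarith [(abs_le.1 hx).1, Real.pi_gt_three]) (by linarith [(abs_le.1 hx).2, Real.pi_gt_three])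

theorem abs_mul_sin_le (γ x : ℝ) : |x * Real.sin (γ * x)| ≤ |γ| * x ^ 2 := by
  rw [abs_mul]
  calc |x| * |Real.sin (γ * x)| ≤ |x| * |γ * x| := by
        exact mul_le_mul_of_nonneg_left Real.abs_sin_le_abs (abs_nonneg _)
    _ = |γ| * x ^ 2 := by rw [abs_mul, ← sq_abs x]; ring

theorem abs_cos_sub_cos_le (γ a b : ℝ) :
    |Real.cos (γ * a) - Real.cos (γ * b)| ≤ γ ^ 2 * (a ^ 2 + b ^ 2) / 2 := by
  have h1 := Real.one_sub_sq_div_two_le_cos (x := γ * a)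
  have h2 := Real.one_sub_sq_div_two_le_cos (x := γ * b)
  have h3 := Real.cos_le_one (γ * a)
  have h4 := Real.cos_le_one (γ * b)
  rw [abs_le]
  constructor <;> nlinarith [mul_self_nonneg (γ * a), mul_self_nonneg (γ * b)]

section

variable {V : Type*} [DecidableEq V]

omit [DecidableEq V] in
theorem abs_prod_cos_le_one (γ : ℝ) (y : V → ℝ) (s : Finset V) :
    |∏ x ∈ s, Real.cos (γ * y x)| ≤ 1 := by
  rw [Finset.abs_prod]
  exact Finset.prod_le_one (fun _ _ => abs_nonneg _) fun _ _ => Real.abs_cos_le_one _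

/-- With T = ∑ (γ y_v)², the v-th term times |γ| is at most (γ y_v)² exp(-(T - (γ y_v)²)/4), since
|sin s| ≤ |s| and cos s ≤ exp(-s²/4) for |s| ≤ 1. The omitted cosine costs a factor at most 2, and
2T exp(-T/4) ≤ 8. The bound does not depend on the number of terms. -/
theorem abs_mul_abs_sum_star_le (γ : ℝ) (y : V → ℝ) (s : Finset V) (hy : ∀ v ∈ s, |γ * y v| ≤ 1) :
    |γ| * |∑ v ∈ s, y v * Real.sin (γ * y v) * ∏ x ∈ s.erase v, Real.cos (γ * y x)| ≤ 8 := by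
  set T := ∑ v ∈ s, (γ * y v) ^ 2 with hT
  have hT0 : 0 ≤ T := Finset.sum_nonneg fun _ _ => sq_nonneg _
  have hterm : ∀ v ∈ s, |γ| * |y v * Real.sin (γ * y v) * ∏ x ∈ s.erase v, Real.cos (γ * y x)| ≤
      (γ * y v) ^ 2 * (2 * Real.exp (-(T / 4))) := by
    intro v hv
    have h1 : |∏ x ∈ s.erase v, Real.cos (γ * y x)| ≤ 2 * Real.exp (-(T / 4)) := by
      rw [Finset.abs_prod]
      calc ∏ x ∈ s.erase v, |Real.cos (γ * y x)|
          ≤ ∏ x ∈ s.erase v, Real.exp (-((γ * y x) ^ 2 / 4)) := by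
            refine Finset.prod_le_prod (fun _ _ => abs_nonneg _) fun x hx => ?_
            have hx' := hy x (Finset.mem_of_mem_erase hx)
            rw [abs_of_nonneg (cos_nonneg_of_abs_le_one hx')]
            exact cos_le_exp_neg_sq hx'
        _ = Real.exp ((γ * y v) ^ 2 / 4) * Real.exp (-(T / 4)) := by
            rw [← Real.exp_sum, ← Real.exp_add, hT, ← Finset.add_sum_erase s _ hv]
            congr 1
            rw [Finset.sum_neg_distrib, ← Finset.sum_div]
            ring
        _ ≤ 2 * Real.exp (-(T / 4)) := by
            gcongr
            have h2 : (γ * y v) ^ 2 ≤ 1 := by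
              rw [← sq_abs]; exact pow_le_one₀ (abs_nonneg _) (hy v hv)
            calc Real.exp ((γ * y v) ^ 2 / 4) ≤ Real.exp (Real.log 2) := by
                  rw [Real.exp_le_exp]; linarith [Real.log_two_gt_d9]
              _ = 2 := Real.exp_log two_pos
    calc |γ| * |y v * Real.sin (γ * y v) * ∏ x ∈ s.erase v, Real.cos (γ * y x)|
        = |γ| * |y v * Real.sin (γ * y v)| * |∏ x ∈ s.erase v, Real.cos (γ * y x)| := by
          rw [abs_mul, mul_assoc]
      _ ≤ |γ| * (|γ| * y v ^ 2) * (2 * Real.exp (-(T / 4))) := by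
          gcongr; exact abs_mul_sin_le _ _
      _ = _ := by rw [mul_pow, ← sq_abs γ]; ring
  calc _ ≤ |γ| * ∑ v ∈ s, |y v * Real.sin (γ * y v) * ∏ x ∈ s.erase v, Real.cos (γ * y x)| := by
        gcongr; exact Finset.abs_sum_le_sum_abs _ _
    _ ≤ T * (2 * Real.exp (-(T / 4))) := by
        rw [Finset.mul_sum, hT, Finset.sum_mul]
        exact Finset.sum_le_sum hterm
    _ ≤ 8 := by
        have h3 : T / 4 ≤ Real.exp (T / 4) := by linarith [Real.add_one_le_exp (T / 4)]
        have h4 : T / 4 * Real.exp (-(T / 4)) ≤ 1 := by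
          rw [Real.exp_neg, ← div_eq_mul_inv]
          exact div_le_one_of_le₀ h3 (Real.exp_pos _).le
        linarith

variable [Fintype V]

/-- The dependence on one coordinate is only through a sin(γa) and cos(γa), with coefficients free
of that coordinate; bounding influence reduces to bounding the two coefficients. -/
theorem starEnergy_update (γ : ℝ) (y : V → ℝ) (k : V) (a : ℝ) :
    starEnergy γ (Function.update y k a) =
      a * Real.sin (γ * a) * ∏ x ∈ Finset.univ.erase k, Real.cos (γ * y x) +
      Real.cos (γ * a) * ∑ v ∈ Finset.univ.erase k, y v * Real.sin (γ * y v) *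
        ∏ x ∈ (Finset.univ.erase k).erase v, Real.cos (γ * y x) := by
  unfold starEnergy
  rw [← Finset.add_sum_erase _ _ (Finset.mem_univ k), Function.update_self, Finset.mul_sum]
  congr 1
  · congr 1
    exact Finset.prod_congr rfl fun x hx => by
      rw [Function.update_of_ne (Finset.ne_of_mem_erase hx)]
  · refine Finset.sum_congr rfl fun v hv => ?_
    have hvk := Finset.ne_of_mem_erase hv
    rw [Function.update_of_ne hvk, ← Finset.mul_prod_erase (Finset.univ.erase v) _
      (Finset.mem_erase.2 ⟨hvk.symm, Finset.mem_univ k⟩), Function.update_self,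
      Finset.erase_right_comm]
    rw [Finset.prod_congr rfl fun x hx => by
      rw [Function.update_of_ne (Finset.ne_of_mem_erase (Finset.mem_of_mem_erase hx))]]
    ring

/-- The influence of a single weight on `starEnergy`. -/
theorem abs_starEnergy_update_sub_le (γ : ℝ) (y : V → ℝ) (hy : ∀ v, |γ * y v| ≤ 1) (k : V)
    (a b : ℝ) :
    |starEnergy γ (Function.update y k a) - starEnergy γ (Function.update y k b)| ≤
      5 * |γ| * (a ^ 2 + b ^ 2) := by
  rw [starEnergy_update, starEnergy_update]
  set P := ∏ x ∈ Finset.univ.erase k, Real.cos (γ * y x)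
  set A := ∑ v ∈ Finset.univ.erase k, y v * Real.sin (γ * y v) *
        ∏ x ∈ (Finset.univ.erase k).erase v, Real.cos (γ * y x)
  have hP : |P| ≤ 1 := abs_prod_cos_le_one _ _ _
  have hA : |γ| * |A| ≤ 8 := abs_mul_abs_sum_star_le _ _ _ fun v _ => hy v
  have h1 : |a * Real.sin (γ * a) - b * Real.sin (γ * b)| ≤ |γ| * a ^ 2 + |γ| * b ^ 2 :=
    (abs_sub _ _).trans (add_le_add (abs_mul_sin_le _ _) (abs_mul_sin_le _ _))
  calc _ = |(a * Real.sin (γ * a) - b * Real.sin (γ * b)) * P +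
        (Real.cos (γ * a) - Real.cos (γ * b)) * A| := by congr 1; ring
    _ ≤ |a * Real.sin (γ * a) - b * Real.sin (γ * b)| * |P| +
        |Real.cos (γ * a) - Real.cos (γ * b)| * |A| := by
        rw [← abs_mul, ← abs_mul]; exact abs_add_le _ _
    -- The cosine difference is of order γ², which the O(1/|γ|) bound on `A` reduces to order |γ|.
    -- The final constant is 5 = 1 + 8/2.
    _ ≤ (|γ| * a ^ 2 + |γ| * b ^ 2) * 1 + (γ ^ 2 * (a ^ 2 + b ^ 2) / 2) * |A| := by
        gcongr; exact abs_cos_sub_cos_le _ _ _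
    _ = (|γ| * a ^ 2 + |γ| * b ^ 2) + |γ| * (a ^ 2 + b ^ 2) / 2 * (|γ| * |A|) := by
        rw [← sq_abs γ]; ring
    _ ≤ (|γ| * a ^ 2 + |γ| * b ^ 2) + |γ| * (a ^ 2 + b ^ 2) / 2 * 8 := by gcongr
    _ = _ := by ring

theorem abs_starEnergy_le (γ : ℝ) (y : V → ℝ) : |starEnergy γ y| ≤ |γ| * ∑ v, y v ^ 2 := by
  rw [Finset.mul_sum]
  refine (Finset.abs_sum_le_sum_abs _ _).trans (Finset.sum_le_sum fun v _ => ?_)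
  rw [abs_mul]
  exact (mul_le_of_le_one_right (abs_nonneg _) (abs_prod_cos_le_one _ _ _)).trans
    (abs_mul_sin_le _ _)

theorem abs_starEnergy_le_sum_abs (γ : ℝ) (y : V → ℝ) : |starEnergy γ y| ≤ ∑ v, |y v| := by
  refine (Finset.abs_sum_le_sum_abs _ _).trans (Finset.sum_le_sum fun v _ => ?_)
  rw [abs_mul, abs_mul, mul_assoc]
  exact mul_le_of_le_one_right (abs_nonneg _)
    (mul_le_one₀ (Real.abs_sin_le_one _) (abs_nonneg _) (abs_prod_cos_le_one _ _ _))

/-- The effect of truncation on `starEnergy`. -/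
theorem abs_starEnergy_sub_trunc_le (γ : ℝ) (y : V → ℝ) (s : Finset V) (hs : ∀ v ∉ s, y v = 0) :
    |starEnergy γ y - starEnergy γ (fun v => trunc γ (y v))| ≤
      2 * |γ| * (s.card + 1) * ∑ v, excess γ (y v) := by
  by_cases hall : ∀ v, |γ * y v| ≤ 1
  · have : (fun v => trunc γ (y v)) = y := funext fun v => if_pos (hall v)
    rw [this, sub_self, abs_zero]
    have : 0 ≤ ∑ v, excess γ (y v) := Finset.sum_nonneg fun v _ => excess_nonneg _ _
    positivity
  · push Not at hall
    obtain ⟨k, hk⟩ := hall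
    set S := ∑ v, excess γ (y v) with hS
    have hkS : y k ^ 2 ≤ S := by
      have : excess γ (y k) = y k ^ 2 := if_neg (not_le.2 hk)
      rw [← this]
      exact Finset.single_le_sum (f := fun v => excess γ (y v)) (fun v _ => excess_nonneg _ _)
        (Finset.mem_univ k)
    have hS0 : 0 ≤ S := (sq_nonneg _).trans hkS
    -- One weight beyond the threshold dominates every truncated weight, so the whole truncated mass
    -- on `s` is at most `s.card` times the excess; the excess itself supplies the extra 1.
    have hsmall : ∀ v, trunc γ (y v) ^ 2 ≤ y k ^ 2 := by
      intro v
      have h1 : |γ * trunc γ (y v)| ≤ |γ * y k| := (abs_mul_trunc_le _ _).trans hk.le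
      have hγ : 0 < |γ| := by
        rw [abs_pos]; rintro rfl; simp at hk; linarith
      rw [abs_mul, abs_mul] at h1
      exact sq_le_sq.2 (le_of_mul_le_mul_left h1 hγ)
    have hdecomp : ∀ v, y v ^ 2 = trunc γ (y v) ^ 2 + excess γ (y v) := by
      intro v
      unfold trunc excess
      split_ifs <;> simp
    have htot : ∑ v, y v ^ 2 ≤ (s.card + 1) * S := by
      simp only [hdecomp, Finset.sum_add_distrib]
      have : ∑ v, trunc γ (y v) ^ 2 ≤ s.card * S := by
        rw [← Finset.sum_subset (Finset.subset_univ s)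
          (fun v _ hv => by rw [hs v hv, trunc_zero]; simp)]
        calc ∑ v ∈ s, trunc γ (y v) ^ 2 ≤ ∑ v ∈ s, S :=
              Finset.sum_le_sum fun v _ => (hsmall v).trans hkS
          _ = s.card * S := by simp
      linarith
    have htr : ∑ v, trunc γ (y v) ^ 2 ≤ ∑ v, y v ^ 2 :=
      Finset.sum_le_sum fun v _ => trunc_sq_le _ _
    calc _ ≤ |starEnergy γ y| + |starEnergy γ (fun v => trunc γ (y v))| := abs_sub _ _
      _ ≤ |γ| * ∑ v, y v ^ 2 + |γ| * ∑ v, y v ^ 2 := by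
          gcongr
          · exact abs_starEnergy_le _ _
          · exact (abs_starEnergy_le _ _).trans (by gcongr)
      _ = 2 * |γ| * ∑ v, y v ^ 2 := by ring
      _ ≤ 2 * |γ| * ((s.card + 1) * S) := by gcongr
      _ = _ := by ring

variable (G : SimpleGraph V) [DecidableRel G.Adj]

/-- The objective with the weights truncated in its nonlinear part. -/
noncomputable def truncObjective (γ : ℝ) (w : G.edgeSet → ℝ) : ℝ :=
  1 / 2 * ∑ e, w e + 1 / 4 * ∑ u, starEnergy γ (edgeWeight G (fun e => trunc γ (w e)) u)

omit [Fintype V] [DecidableEq V] in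
theorem edgeWeight_comp (f : ℝ → ℝ) (hf : f 0 = 0) (w : G.edgeSet → ℝ) (u v : V) :
    edgeWeight G (fun e => f (w e)) u v = f (edgeWeight G w u v) := by
  unfold edgeWeight
  split_ifs
  · rfl
  · exact hf.symm

omit [Fintype V] in
theorem edgeWeight_update (w : G.edgeSet → ℝ) {p q : V} (h : G.Adj p q) (a : ℝ) :
    edgeWeight G (Function.update w ⟨s(p, q), h⟩ a) p =
      Function.update (edgeWeight G w p) q a := by
  ext x
  by_cases hx : x = q
  · subst hx; simp [edgeWeight, h]
  · rw [Function.update_of_ne hx]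
    unfold edgeWeight
    split_ifs with h1
    · rw [Function.update_of_ne]
      simpa [Subtype.ext_iff, hx] using fun h1 h2 => hx (h2.trans h1)
    · rfl

omit [Fintype V] in
theorem edgeWeight_update_of_ne (w : G.edgeSet → ℝ) {p q : V} (h : G.Adj p q) (a : ℝ) {u : V}
    (hp : u ≠ p) (hq : u ≠ q) :
    edgeWeight G (Function.update w ⟨s(p, q), h⟩ a) u = edgeWeight G w u := by
  ext x
  unfold edgeWeight
  split_ifs with h1
  · rw [Function.update_of_ne]
    simp [Subtype.ext_iff, hp, hq]
  · rfl

/-- The influence of a single weight on the truncated objective. -/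
theorem abs_truncObjective_update_sub_le (γ : ℝ) (w : G.edgeSet → ℝ) (e : G.edgeSet) (a b : ℝ) :
    |truncObjective G γ (Function.update w e a) - truncObjective G γ (Function.update w e b)| ≤
      (1 + 3 * |γ|) * (1 + a ^ 2) + (1 + 3 * |γ|) * (1 + b ^ 2) := by
  obtain ⟨s, hs⟩ := e
  induction s using Sym2.ind with
  | _ p q =>
    have h : G.Adj p q := hs
    set W : ℝ → V → V → ℝ := fun c =>
      edgeWeight G (fun e => trunc γ (Function.update w ⟨s(p, q), hs⟩ c e)) with hW
    have htr : ∀ c, (fun e => trunc γ (Function.update w ⟨s(p, q), hs⟩ c e)) =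
        Function.update (fun e => trunc γ (w e)) ⟨s(p, q), h⟩ (trunc γ c) := by
      intro c
      ext e
      by_cases he : e = ⟨s(p, q), h⟩
      · subst he; simp
      · rw [Function.update_of_ne he, Function.update_of_ne he]
    have hlin : ∀ c, ∑ e, Function.update w ⟨s(p, q), hs⟩ c e =
        c + ∑ e ∈ Finset.univ.erase ⟨s(p, q), hs⟩, w e := by
      intro c
      rw [← Finset.add_sum_erase _ _ (Finset.mem_univ ⟨s(p, q), hs⟩), Function.update_self]
      congr 1
      exact Finset.sum_congr rfl fun x hx => Function.update_of_ne (Finset.ne_of_mem_erase hx) _ _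
    have hy : ∀ u v, |γ * edgeWeight G (fun e => trunc γ (w e)) u v| ≤ 1 := by
      intro u v
      rw [edgeWeight_comp G (trunc γ) (trunc_zero γ)]
      exact abs_mul_trunc_le _ _
    have hsq : 5 * |γ| * (trunc γ a ^ 2 + trunc γ b ^ 2) ≤ 5 * |γ| * (a ^ 2 + b ^ 2) := by
      have h1 := trunc_sq_le γ a
      have h2 := trunc_sq_le γ b
      have h3 : 0 ≤ 5 * |γ| := by positivity
      exact mul_le_mul_of_nonneg_left (add_le_add h1 h2) h3
    -- The weight of pq enters only the stars centred at p and q. Their total 10|γ|, times 1/4, is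
    -- rounded up to 3|γ| at the end.
    have hstar : ∀ u, |starEnergy γ (W a u) - starEnergy γ (W b u)| ≤
        (if u = p then 5 * |γ| * (a ^ 2 + b ^ 2) else 0) +
        (if u = q then 5 * |γ| * (a ^ 2 + b ^ 2) else 0) := by
      intro u
      simp only [hW, htr]
      by_cases hp : u = p
      · subst hp
        rw [if_pos rfl, if_neg h.ne, add_zero, edgeWeight_update G _ h, edgeWeight_update G _ h]
        exact (abs_starEnergy_update_sub_le γ _ (hy u) q _ _).trans hsq
      · by_cases hq : u = q
        · subst hq
          rw [if_neg hp, if_pos rfl, zero_add]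
          have hsw : (⟨s(p, u), h⟩ : G.edgeSet) = ⟨s(u, p), h.symm⟩ :=
            Subtype.ext Sym2.eq_swap
          rw [hsw, edgeWeight_update G _ h.symm, edgeWeight_update G _ h.symm]
          exact (abs_starEnergy_update_sub_le γ _ (hy u) p _ _).trans hsq
        · rw [edgeWeight_update_of_ne G _ h _ hp hq, edgeWeight_update_of_ne G _ h _ hp hq]
          simp [hp, hq]
    have hsum : |∑ u, starEnergy γ (W a u) - ∑ u, starEnergy γ (W b u)| ≤
        10 * |γ| * (a ^ 2 + b ^ 2) := by
      rw [← Finset.sum_sub_distrib]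
      refine (Finset.abs_sum_le_sum_abs _ _).trans ((Finset.sum_le_sum fun u _ => hstar u).trans ?_)
      rw [Finset.sum_add_distrib]
      simp only [Finset.sum_ite_eq', Finset.mem_univ, if_true]
      linarith
    unfold truncObjective
    rw [hlin, hlin]
    have habs : |a - b| ≤ (1 + a ^ 2) + (1 + b ^ 2) := by
      rw [abs_le]; constructor <;> nlinarith [sq_nonneg (a + 1), sq_nonneg (a - 1),
        sq_nonneg (b + 1), sq_nonneg (b - 1)]
    calc _ = |1 / 2 * (a - b) +
          1 / 4 * (∑ u, starEnergy γ (W a u) - ∑ u, starEnergy γ (W b u))| := by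
          congr 1; simp only [hW]; ring
      _ ≤ |1 / 2 * (a - b)| +
          |1 / 4 * (∑ u, starEnergy γ (W a u) - ∑ u, starEnergy γ (W b u))| := abs_add_le _ _
      _ ≤ 1 / 2 * ((1 + a ^ 2) + (1 + b ^ 2)) + 1 / 4 * (10 * |γ| * (a ^ 2 + b ^ 2)) := by
          rw [abs_mul, abs_mul, abs_of_pos (by norm_num : (0 : ℝ) < 1 / 2),
            abs_of_pos (by norm_num : (0 : ℝ) < 1 / 4)]
          gcongr
      _ ≤ _ := by nlinarith [mul_nonneg (abs_nonneg γ) (sq_nonneg a),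
          mul_nonneg (abs_nonneg γ) (sq_nonneg b), sq_nonneg a, sq_nonneg b, abs_nonneg γ]

/-- The effect of truncation on the objective. -/
theorem abs_objective_sub_truncObjective_le (hG : G.CliqueFree 3) {d : ℕ}
    (hd : G.IsRegularOfDegree d) (γ : ℝ) (w : G.edgeSet → ℝ) :
    |objective G γ w - truncObjective G γ w| ≤ |γ| * (d + 1) * ∑ e, excess γ (w e) := by
  rw [objective_eq G hG, truncObjective]
  have h1 : ∀ u, |starEnergy γ (edgeWeight G w u) -
      starEnergy γ (edgeWeight G (fun e => trunc γ (w e)) u)| ≤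
      2 * |γ| * (d + 1) * ∑ v, edgeWeight G (fun e => excess γ (w e)) u v := by
    intro u
    have h := abs_starEnergy_sub_trunc_le γ (edgeWeight G w u) (G.neighborFinset u) fun v hv =>
      edgeWeight_of_not_adj G w (by simpa using hv)
    have hc : (G.neighborFinset u).card = d := hd u
    rw [hc] at h
    have e1 : edgeWeight G (fun e => trunc γ (w e)) u = fun v => trunc γ (edgeWeight G w u v) :=
      funext fun v => edgeWeight_comp G (trunc γ) (trunc_zero γ) w u v
    have e2 : ∀ v, edgeWeight G (fun e => excess γ (w e)) u v = excess γ (edgeWeight G w u v) :=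
      fun v => edgeWeight_comp G (excess γ) (by simp [excess]) w u v
    simp only [e1, e2]
    exact h
  calc _ = |1 / 4 * ∑ u, (starEnergy γ (edgeWeight G w u) -
      starEnergy γ (edgeWeight G (fun e => trunc γ (w e)) u))| := by
        rw [Finset.sum_sub_distrib]; congr 1; ring
    _ ≤ 1 / 4 * ∑ u, 2 * |γ| * (d + 1) * ∑ v, edgeWeight G (fun e => excess γ (w e)) u v := by
        rw [abs_mul, abs_of_pos (by norm_num : (0 : ℝ) < 1 / 4)]
        gcongr
        exact (Finset.abs_sum_le_sum_abs _ _).trans (Finset.sum_le_sum fun u _ => h1 u)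
    _ = _ := by
        rw [← Finset.mul_sum, sum_sum_edgeWeight]; ring

/-- A crude bound, linear in the weights, which serves for integrability. -/
theorem abs_objective_le (hG : G.CliqueFree 3) (γ : ℝ) (w : G.edgeSet → ℝ) :
    |objective G γ w| ≤ ∑ e, |w e| := by
  rw [objective_eq G hG]
  have h1 : |∑ u, starEnergy γ (edgeWeight G w u)| ≤ 2 * ∑ e, |w e| := by
    rw [← sum_sum_edgeWeight]
    refine (Finset.abs_sum_le_sum_abs _ _).trans (Finset.sum_le_sum fun u _ => ?_)
    refine (abs_starEnergy_le_sum_abs _ _).trans (Finset.sum_le_sum fun v _ => ?_)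
    rw [edgeWeight_comp G (fun x => |x|) abs_zero]
  have h2 : |∑ e, w e| ≤ ∑ e, |w e| := Finset.abs_sum_le_sum_abs _ _
  rw [abs_le] at *
  constructor <;> linarith [h1.1, h1.2, h2.1, h2.2]

end

/-! ### Exponential concentration from one-coordinate oscillation bounds. -/

theorem exp_le_one_add_add_sq_mul_exp_abs (x : ℝ) :
    Real.exp x ≤ 1 + x + x ^ 2 * Real.exp |x| := by
  have h := Complex.norm_exp_sub_sum_le_norm_mul_exp (x : ℂ) 2
  have h2 : Complex.exp x - ∑ m ∈ Finset.range 2, (x : ℂ) ^ m / (m.factorial : ℂ) =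
      ((Real.exp x - (1 + x) : ℝ) : ℂ) := by
    simp [Finset.sum_range_succ]
  rw [h2, Complex.norm_real, Complex.norm_real, Real.norm_eq_abs, Real.norm_eq_abs, sq_abs] at h
  linarith [(abs_le.1 h).2]

section

variable {ρ : Measure ℝ} [IsProbabilityMeasure ρ] {g : ℝ → ℝ}

/-- The variance proxy of a function whose one-coordinate oscillations are controlled by `g`. -/
noncomputable def varianceProxy (ρ : Measure ℝ) (g : ℝ → ℝ) : ℝ :=
  ∫ x, 2 * Real.exp (2 * (g x + ∫ y, g y ∂ρ)) ∂ρ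

omit [IsProbabilityMeasure ρ] in
theorem integrable_of_exp (hgm : Measurable g) (hg0 : ∀ x, 0 ≤ g x)
    (hg : Integrable (fun x => Real.exp (2 * g x)) ρ) : Integrable g ρ := by
  refine hg.mono' hgm.aestronglyMeasurable (ae_of_all _ fun x => ?_)
  rw [Real.norm_of_nonneg (hg0 x)]
  linarith [Real.add_one_le_exp (2 * g x), hg0 x]

omit [IsProbabilityMeasure ρ] in
theorem varianceProxy_nonneg : 0 ≤ varianceProxy ρ g :=
  integral_nonneg fun _ => by positivity

theorem integrable_of_oscillation (hgm : Measurable g) (hg0 : ∀ x, 0 ≤ g x)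
    (hg : Integrable (fun x => Real.exp (2 * g x)) ρ) {h : ℝ → ℝ} (hm : Measurable h)
    (hosc : ∀ a b, |h a - h b| ≤ g a + g b) : Integrable h ρ := by
  refine (((integrable_of_exp hgm hg0 hg).add (integrable_const (g 0 + |h 0|)))).mono'
    hm.aestronglyMeasurable (ae_of_all _ fun x => ?_)
  have h1 := hosc x 0
  have h2 := abs_sub_abs_le_abs_sub (h x) (h 0)
  simp only [Pi.add_apply, Real.norm_eq_abs]
  linarith

/-- The one-variable moment generating function estimate. -/
theorem lintegral_exp_sub_integral_le (hgm : Measurable g) (hg0 : ∀ x, 0 ≤ g x)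
    (hg : Integrable (fun x => Real.exp (2 * g x)) ρ) {h : ℝ → ℝ} (hm : Measurable h)
    (hosc : ∀ a b, |h a - h b| ≤ g a + g b) {t : ℝ} (ht : |t| ≤ 1) :
    ∫⁻ x, ENNReal.ofReal (Real.exp (t * (h x - ∫ y, h y ∂ρ))) ∂ρ ≤
      ENNReal.ofReal (Real.exp (t ^ 2 * varianceProxy ρ g)) := by
  have hgi := integrable_of_exp hgm hg0 hg
  have hhi := integrable_of_oscillation hgm hg0 hg hm hosc
  set m := ∫ y, h y ∂ρ with hmdef
  set G := ∫ y, g y ∂ρ with hGdef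
  have hdev : ∀ x, |h x - m| ≤ g x + G := by
    intro x
    have h1 : h x - m = ∫ y, (h x - h y) ∂ρ := by
      rw [integral_sub (integrable_const _) hhi]; simp [hmdef]
    have h2 : g x + G = ∫ y, (g x + g y) ∂ρ := by
      rw [integral_add (integrable_const _) hgi]; simp [hGdef]
    rw [h1, h2]
    refine (abs_integral_le_integral_abs).trans (integral_mono ?_ ?_ fun y => hosc x y)
    · exact ((integrable_const _).sub hhi).abs
    · exact (integrable_const _).add hgi
  have hpt : ∀ x, Real.exp (t * (h x - m)) ≤
      1 + t * (h x - m) + t ^ 2 * (2 * Real.exp (2 * (g x + G))) := by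
    intro x
    have h1 := exp_le_one_add_add_sq_mul_exp_abs (t * (h x - m))
    set u := g x + G
    have hu : 0 ≤ u := (abs_nonneg _).trans (hdev x)
    have h2 : |t * (h x - m)| ≤ u := by
      rw [abs_mul]
      exact (mul_le_of_le_one_left (abs_nonneg _) ht).trans (hdev x)
    -- One factor exp u comes from u² ≤ 2 exp u and another from exp|t(h - m)| with |t| ≤ 1; this is
    -- the source of 2 exp(2u) in `varianceProxy`.
    have h3 : (h x - m) ^ 2 ≤ 2 * Real.exp u := by
      have h4 : (h x - m) ^ 2 ≤ u ^ 2 := by rw [← sq_abs]; gcongr; exact hdev x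
      have h5 := Real.quadratic_le_exp_of_nonneg hu
      linarith
    calc _ ≤ 1 + t * (h x - m) + (t * (h x - m)) ^ 2 * Real.exp |t * (h x - m)| := h1
      _ ≤ 1 + t * (h x - m) + t ^ 2 * (2 * Real.exp u * Real.exp u) := by
          rw [mul_pow, mul_assoc]
          gcongr
      _ = _ := by rw [mul_assoc 2, ← Real.exp_add, two_mul u]
  have hE : Integrable (fun x => 2 * Real.exp (2 * (g x + G))) ρ := by
    have : (fun x => 2 * Real.exp (2 * (g x + G))) =
        fun x => (2 * Real.exp (2 * G)) * Real.exp (2 * g x) := by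
      ext x; rw [mul_add, Real.exp_add]; ring
    rw [this]
    exact hg.const_mul _
  have hdevi : Integrable (fun x => t * (h x - m)) ρ := (hhi.sub (integrable_const _)).const_mul _
  have hrhs : Integrable (fun x => 1 + t * (h x - m) + t ^ 2 * (2 * Real.exp (2 * (g x + G)))) ρ :=
    ((integrable_const _).add hdevi).add (hE.const_mul _)
  calc _ ≤ ∫⁻ x, ENNReal.ofReal
        (1 + t * (h x - m) + t ^ 2 * (2 * Real.exp (2 * (g x + G)))) ∂ρ :=
        lintegral_mono fun x => ENNReal.ofReal_le_ofReal (hpt x)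
    _ = ENNReal.ofReal (∫ x, (1 + t * (h x - m) + t ^ 2 * (2 * Real.exp (2 * (g x + G)))) ∂ρ) := by
        rw [ofReal_integral_eq_lintegral_ofReal hrhs]
        exact ae_of_all _ fun x => (Real.exp_pos _).le.trans (hpt x)
    _ = ENNReal.ofReal (1 + t ^ 2 * varianceProxy ρ g) := by
        congr 1
        have h1 : ∫ x, (1 + t * (h x - m)) ∂ρ = 1 := by
          rw [integral_add (integrable_const _) hdevi, integral_const_mul,
            integral_sub hhi (integrable_const _)]
          simp [hmdef]
        have h2 : Integrable (fun x => 1 + t * (h x - m)) ρ := (integrable_const _).add hdevi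
        rw [integral_add h2 (hE.const_mul _), integral_const_mul, h1]
        rfl
    _ ≤ _ := by
        refine ENNReal.ofReal_le_ofReal ?_
        linarith [Real.add_one_le_exp (t ^ 2 * varianceProxy ρ g)]

/-- The coordinates of 0 are replaced by those of `w` one at a time, and the oscillations are
summed. -/
theorem abs_le_sum_of_oscillation {ι : Type*} [Fintype ι] [DecidableEq ι] {f : (ι → ℝ) → ℝ}
    (hosc : ∀ w i a b, |f (Function.update w i a) - f (Function.update w i b)| ≤ g a + g b)
    (w : ι → ℝ) : |f w| ≤ |f 0| + ∑ i, (g (w i) + g 0) := by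
  have key : ∀ s : Finset ι, |f (s.piecewise w 0)| ≤ |f 0| + ∑ i ∈ s, (g (w i) + g 0) := by
    intro s
    induction s using Finset.induction_on with
    | empty => simp
    | insert i s hi ih =>
      rw [Finset.sum_insert hi, Finset.piecewise_insert]
      have h0 : Function.update (s.piecewise w 0) i ((0 : ι → ℝ) i) = s.piecewise w 0 := by
        apply Function.update_eq_self_iff.2
        simp [hi]
      have h1 := hosc (s.piecewise w 0) i (w i) ((0 : ι → ℝ) i)
      rw [h0] at h1
      have h2 := abs_sub_abs_le_abs_sub (f (Function.update (s.piecewise w 0) i (w i)))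
        (f (s.piecewise w 0))
      simp only [Pi.zero_apply] at h1
      linarith
  simpa using key Finset.univ

theorem integrable_pi_of_oscillation {ι : Type*} [Fintype ι] [DecidableEq ι]
    (hgm : Measurable g) (hg0 : ∀ x, 0 ≤ g x)
    (hg : Integrable (fun x => Real.exp (2 * g x)) ρ) {f : (ι → ℝ) → ℝ} (hm : Measurable f)
    (hosc : ∀ w i a b, |f (Function.update w i a) - f (Function.update w i b)| ≤ g a + g b) :
    Integrable f (Measure.pi fun _ => ρ) := by
  have hgi := integrable_of_exp hgm hg0 hg
  refine Integrable.mono' (g := fun w => |f 0| + ∑ i, (g (w i) + g 0)) ?_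
    hm.aestronglyMeasurable (ae_of_all _ fun w => abs_le_sum_of_oscillation hosc w)
  refine (integrable_const _).add (integrable_finsetSum _ fun i _ => ?_)
  exact (integrable_comp_eval (μ := fun _ : ι => ρ) (i := i) hgi).add (integrable_const _)

/-- The moment generating function of a function of finitely many independent variables with
controlled one-coordinate oscillations. -/
theorem lintegral_exp_sub_integral_le_fin (hgm : Measurable g) (hg0 : ∀ x, 0 ≤ g x)
    (hg : Integrable (fun x => Real.exp (2 * g x)) ρ) {t : ℝ} (ht : |t| ≤ 1) (n : ℕ)
    {f : (Fin n → ℝ) → ℝ} (hm : Measurable f)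
    (hosc : ∀ w i a b, |f (Function.update w i a) - f (Function.update w i b)| ≤ g a + g b) :
    ∫⁻ w, ENNReal.ofReal (Real.exp (t * (f w - ∫ w', f w' ∂(Measure.pi fun _ => ρ))))
        ∂(Measure.pi fun _ => ρ) ≤
      ENNReal.ofReal (Real.exp (n * (t ^ 2 * varianceProxy ρ g))) := by
  induction n with
  | zero =>
    have h1 : ∀ w, f w = f 0 := fun w => congrArg f (Subsingleton.elim _ _)
    simp only [h1]
    simp
  | succ n ih =>
    set π : Measure (Fin n → ℝ) := Measure.pi fun _ => ρ with hπ
    have hmp := (measurePreserving_piFinSuccAbove (fun _ : Fin (n + 1) => ρ) 0).symm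
    set F : ℝ × (Fin n → ℝ) → ℝ := fun p => f (Fin.cons p.1 p.2) with hF
    have hFeq : ∀ p, f ((MeasurableEquiv.piFinSuccAbove (fun _ : Fin (n + 1) => ℝ) 0).symm p) =
        F p := by
      intro p
      simp [hF, MeasurableEquiv.piFinSuccAbove_symm_apply, Fin.insertNthEquiv]
    have hFm : Measurable F := by
      have : F = f ∘ (MeasurableEquiv.piFinSuccAbove (fun _ : Fin (n + 1) => ℝ) 0).symm :=
        funext fun p => (hFeq p).symm
      rw [this]
      exact hm.comp (MeasurableEquiv.measurable _)
    have hfi := integrable_pi_of_oscillation hgm hg0 hg hm hosc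
    have hFi : Integrable F (ρ.prod π) := by
      have := (hmp.integrable_comp_emb (MeasurableEquiv.measurableEmbedding _)).2 hfi
      refine this.congr (ae_of_all _ fun p => hFeq p)
    have hslice : ∀ x, ∀ y i a b, |F (x, Function.update y i a) - F (x, Function.update y i b)| ≤
        g a + g b := by
      intro x y i a b
      have := hosc (Fin.cons x y) i.succ a b
      rwa [← Fin.cons_update, ← Fin.cons_update] at this
    have hslm : ∀ x, Measurable fun y => F (x, y) := fun x => hFm.comp measurable_prodMk_left
    have hsli : ∀ x, Integrable (fun y => F (x, y)) π := fun x =>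
      integrable_pi_of_oscillation hgm hg0 hg (hslm x) (hslice x)
    -- Averaging over the remaining coordinates preserves the oscillation bound in the first one.
    -- Thus exp(t(f - E f)) splits into exp(t(h - E h)), handled by the one-variable estimate, and
    -- exp(t(F - h)), handled by induction on each slice.
    set h : ℝ → ℝ := fun x => ∫ y, F (x, y) ∂π with hh
    have hhm : Measurable h := hFm.stronglyMeasurable.integral_prod_right.measurable
    have hhosc : ∀ a b, |h a - h b| ≤ g a + g b := by
      intro a b
      simp only [hh]
      rw [← integral_sub (hsli a) (hsli b)]
      have hb : ∀ y, ‖F (a, y) - F (b, y)‖ ≤ g a + g b := by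
        intro y
        have := hosc (Fin.cons 0 y) 0 a b
        rwa [Fin.update_cons_zero, Fin.update_cons_zero] at this
      have := norm_integral_le_of_norm_le_const (μ := π) (ae_of_all _ hb)
      simpa using this
    have hmean : ∫ w', f w' ∂(Measure.pi fun _ => ρ) = ∫ x, h x ∂ρ := by
      rw [← hmp.integral_comp']
      simp only [hFeq]
      exact integral_prod _ hFi
    have hmeas : Measurable fun w : Fin (n + 1) → ℝ =>
        ENNReal.ofReal (Real.exp (t * (f w - ∫ x, h x ∂ρ))) := by fun_prop
    rw [hmean, ← hmp.lintegral_comp hmeas]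
    simp only [hFeq]
    rw [lintegral_prod _ (by fun_prop)]
    calc ∫⁻ x, ∫⁻ y, ENNReal.ofReal (Real.exp (t * (F (x, y) - ∫ x, h x ∂ρ))) ∂π ∂ρ
        = ∫⁻ x, ENNReal.ofReal (Real.exp (t * (h x - ∫ x, h x ∂ρ))) *
            ∫⁻ y, ENNReal.ofReal (Real.exp (t * (F (x, y) - h x))) ∂π ∂ρ := by
          refine lintegral_congr fun x => ?_
          rw [← lintegral_const_mul _ (by fun_prop)]
          refine lintegral_congr fun y => ?_
          rw [← ENNReal.ofReal_mul (Real.exp_pos _).le, ← Real.exp_add]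
          congr 2; ring
      _ ≤ ∫⁻ x, ENNReal.ofReal (Real.exp (t * (h x - ∫ x, h x ∂ρ))) *
            ENNReal.ofReal (Real.exp (n * (t ^ 2 * varianceProxy ρ g))) ∂ρ := by
          refine lintegral_mono fun x => ?_
          gcongr
          exact ih (hslm x) (hslice x)
      _ ≤ ENNReal.ofReal (Real.exp (t ^ 2 * varianceProxy ρ g)) *
            ENNReal.ofReal (Real.exp (n * (t ^ 2 * varianceProxy ρ g))) := by
          rw [lintegral_mul_const _ (by fun_prop)]
          gcongr
          exact lintegral_exp_sub_integral_le hgm hg0 hg hhm hhosc ht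
      _ = _ := by
          rw [← ENNReal.ofReal_mul (Real.exp_pos _).le, ← Real.exp_add]
          congr 2; push_cast; ring

theorem lintegral_exp_sub_integral_le_pi {ι : Type*} [Fintype ι] [DecidableEq ι]
    (hgm : Measurable g) (hg0 : ∀ x, 0 ≤ g x)
    (hg : Integrable (fun x => Real.exp (2 * g x)) ρ) {t : ℝ} (ht : |t| ≤ 1)
    {f : (ι → ℝ) → ℝ} (hm : Measurable f)
    (hosc : ∀ w i a b, |f (Function.update w i a) - f (Function.update w i b)| ≤ g a + g b) :
    ∫⁻ w, ENNReal.ofReal (Real.exp (t * (f w - ∫ w', f w' ∂(Measure.pi fun _ => ρ))))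
        ∂(Measure.pi fun _ => ρ) ≤
      ENNReal.ofReal (Real.exp (Fintype.card ι * (t ^ 2 * varianceProxy ρ g))) := by
  let e := (Fintype.equivFin ι).symm
  have hmp := measurePreserving_piCongrLeft (fun _ : ι => ρ) e
  have hval : ∀ y : Fin (Fintype.card ι) → ℝ,
      (MeasurableEquiv.piCongrLeft (fun _ : ι => ℝ) e) y = fun i => y (e.symm i) := by
    intro y
    ext i
    obtain ⟨j, rfl⟩ := e.surjective i
    rw [MeasurableEquiv.coe_piCongrLeft, Equiv.piCongrLeft_apply_apply, e.symm_apply_apply]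
  have hmeas : Measurable fun w : ι → ℝ =>
      ENNReal.ofReal (Real.exp (t * (f w - ∫ w', f w' ∂(Measure.pi fun _ => ρ)))) := by fun_prop
  rw [← hmp.lintegral_comp hmeas]
  rw [← hmp.integral_comp']
  simp only [hval]
  refine lintegral_exp_sub_integral_le_fin hgm hg0 hg ht _ (f := fun y => f fun i => y (e.symm i))
    (hm.comp (by fun_prop)) fun w i a b => ?_
  have hupd : ∀ c, (fun j => Function.update w i c (e.symm j)) =
      Function.update (fun j => w (e.symm j)) (e i) c := by
    intro c
    ext j
    by_cases hj : j = e i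
    · subst hj; simp
    · have : e.symm j ≠ i := fun h => hj (by rw [← h, e.apply_symm_apply])
      rw [Function.update_of_ne this, Function.update_of_ne hj]
  rw [hupd, hupd]
  exact hosc _ _ _ _

/-- The Chernoff bound from an estimate of the moment generating function. -/
theorem measureReal_le_of_lintegral_exp_le {Ω : Type*} [MeasurableSpace Ω] (P : Measure Ω)
    [IsProbabilityMeasure P] {X : Ω → ℝ} (hX : Measurable X) {s L t : ℝ} (ht : 0 < t)
    (h : ∫⁻ ω, ENNReal.ofReal (Real.exp (t * X ω)) ∂P ≤ ENNReal.ofReal (Real.exp L)) :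
    P.real {ω | s ≤ X ω} ≤ Real.exp (L - t * s) := by
  have hset : {ω | s ≤ X ω} = {ω | ENNReal.ofReal (Real.exp (t * s)) ≤
      ENNReal.ofReal (Real.exp (t * X ω))} := by
    ext ω
    simp only [Set.mem_ofPred_eq]
    rw [ENNReal.ofReal_le_ofReal_iff (Real.exp_pos _).le, Real.exp_le_exp,
      mul_le_mul_iff_right₀ ht]
  have hmk := mul_meas_ge_le_lintegral (μ := P)
    (f := fun ω => ENNReal.ofReal (Real.exp (t * X ω))) (by fun_prop)
    (ENNReal.ofReal (Real.exp (t * s)))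
  rw [← hset] at hmk
  have h1 := ENNReal.toReal_mono ENNReal.ofReal_ne_top (hmk.trans h)
  rw [ENNReal.toReal_mul, ENNReal.toReal_ofReal (Real.exp_pos _).le,
    ENNReal.toReal_ofReal (Real.exp_pos _).le] at h1
  rw [Real.exp_sub, le_div_iff₀ (Real.exp_pos _), mul_comm]
  exact h1

/-- Two-sided concentration from one-coordinate oscillation bounds. -/
theorem measureReal_abs_sub_integral_ge_le {ι : Type*} [Fintype ι] [DecidableEq ι]
    (hgm : Measurable g) (hg0 : ∀ x, 0 ≤ g x)
    (hg : Integrable (fun x => Real.exp (2 * g x)) ρ) {t : ℝ} (ht0 : 0 < t) (ht : t ≤ 1)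
    {f : (ι → ℝ) → ℝ} (hm : Measurable f)
    (hosc : ∀ w i a b, |f (Function.update w i a) - f (Function.update w i b)| ≤ g a + g b)
    (s : ℝ) :
    (Measure.pi fun _ : ι => ρ).real
        {w | s ≤ |f w - ∫ w', f w' ∂(Measure.pi fun _ => ρ)|} ≤
      2 * Real.exp (Fintype.card ι * (t ^ 2 * varianceProxy ρ g) - t * s) := by
  set m := ∫ w', f w' ∂(Measure.pi fun _ : ι => ρ) with hmdef
  have hsub : {w | s ≤ |f w - m|} ⊆ {w | s ≤ f w - m} ∪ {w | s ≤ m - f w} := by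
    intro w hw
    have hw' : s ≤ |f w - m| := hw
    rcases le_abs.1 hw' with h | h
    · exact Or.inl h
    · exact Or.inr (by simpa [neg_sub] using h)
  have h1 := measureReal_le_of_lintegral_exp_le (Measure.pi fun _ : ι => ρ)
    (X := fun w => f w - m) (by fun_prop) (s := s) ht0
    (lintegral_exp_sub_integral_le_pi hgm hg0 hg (abs_le.2 ⟨by linarith, ht⟩) hm hosc)
  have h2 := lintegral_exp_sub_integral_le_pi hgm hg0 hg (t := -t)
    (abs_le.2 ⟨by linarith, by linarith⟩) hm hosc
  have h3 := measureReal_le_of_lintegral_exp_le (Measure.pi fun _ : ι => ρ)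
    (X := fun w => m - f w) (by fun_prop) (s := s) (t := t) ht0
    (L := Fintype.card ι * (t ^ 2 * varianceProxy ρ g)) (by
      rw [neg_sq] at h2
      refine le_trans (le_of_eq (lintegral_congr fun w => ?_)) h2
      rw [← hmdef]
      congr 2; ring)
  calc _ ≤ (Measure.pi fun _ : ι => ρ).real ({w | s ≤ f w - m} ∪ {w | s ≤ m - f w}) :=
        measureReal_mono hsub
    _ ≤ _ := (measureReal_union_le _ _).trans (by linarith)

end

/-! ### Exponential tails of the excess. -/

section

variable {ρ : Measure ℝ} [IsProbabilityMeasure ρ]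

theorem measurable_trunc (γ : ℝ) : Measurable (trunc γ) := by
  refine Measurable.ite ?_ measurable_id measurable_const
  exact measurableSet_le (by fun_prop) measurable_const

theorem measurable_excess (γ : ℝ) : Measurable (excess γ) := by
  refine Measurable.ite ?_ measurable_const (by fun_prop)
  exact measurableSet_le (by fun_prop) measurable_const

theorem le_sq_of_one_lt_abs_mul {γ r x : ℝ} (hr : 0 ≤ r) (hrγ : r * γ ^ 2 ≤ 1)
    (hx : 1 < |γ * x|) : r ≤ x ^ 2 := by
  have h1 : 1 ≤ γ ^ 2 * x ^ 2 := by
    rw [← mul_pow, ← sq_abs]; exact one_le_pow₀ hx.le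
  nlinarith [sq_nonneg x]

/-- Where the excess is nonzero, x² ≥ r, so half of the exponent in exp(2κx²) pays for the factor
exp(-κr). With r of order D the exponential moment of the excess is exponentially close to 1. -/
theorem exp_mul_excess_le {κ γ r : ℝ} (hκ : 0 < κ) (hr : 0 ≤ r) (hrγ : r * γ ^ 2 ≤ 1) (x : ℝ) :
    Real.exp (κ * excess γ x) ≤ 1 + Real.exp (-(κ * r)) * Real.exp (2 * κ * x ^ 2) := by
  unfold excess
  split_ifs with h
  · rw [mul_zero, Real.exp_zero]
    linarith [mul_pos (Real.exp_pos (-(κ * r))) (Real.exp_pos (2 * κ * x ^ 2))]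
  · have h1 := le_sq_of_one_lt_abs_mul hr hrγ (not_le.1 h)
    rw [← Real.exp_add]
    have : Real.exp (κ * x ^ 2) ≤ Real.exp (-(κ * r) + 2 * κ * x ^ 2) := by
      rw [Real.exp_le_exp]; nlinarith
    linarith

theorem mul_excess_le {κ γ r : ℝ} (hκ : 0 < κ) (hr : 0 ≤ r) (hrγ : r * γ ^ 2 ≤ 1) (x : ℝ) :
    κ * excess γ x ≤ Real.exp (-(κ * r)) * Real.exp (2 * κ * x ^ 2) := by
  have h1 := exp_mul_excess_le hκ hr hrγ x
  have h2 := Real.add_one_le_exp (κ * excess γ x)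
  linarith

omit [IsProbabilityMeasure ρ] in
theorem integrable_excess {κ : ℝ} (hκ : 0 < κ)
    (hint : Integrable (fun x => Real.exp (2 * κ * x ^ 2)) ρ) (γ : ℝ) :
    Integrable (excess γ) ρ := by
  refine (hint.div_const κ).mono' (measurable_excess γ).aestronglyMeasurable
    (ae_of_all _ fun x => ?_)
  rw [Real.norm_of_nonneg (excess_nonneg _ _), le_div_iff₀ hκ]
  have := mul_excess_le hκ le_rfl (γ := γ) (by simp) x
  simp only [mul_zero, neg_zero, Real.exp_zero, one_mul] at this
  linarith

omit [IsProbabilityMeasure ρ] in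
theorem integral_excess_le {κ γ r : ℝ} (hκ : 0 < κ) (hr : 0 ≤ r) (hrγ : r * γ ^ 2 ≤ 1)
    (hint : Integrable (fun x => Real.exp (2 * κ * x ^ 2)) ρ) :
    κ * ∫ x, excess γ x ∂ρ ≤ Real.exp (-(κ * r)) * ∫ x, Real.exp (2 * κ * x ^ 2) ∂ρ := by
  rw [← integral_const_mul, ← integral_const_mul]
  exact integral_mono ((integrable_excess hκ hint γ).const_mul _) (hint.const_mul _)
    fun x => mul_excess_le hκ hr hrγ x

/-- Exponential tail bound for the total excess. -/
theorem measureReal_sum_excess_ge_le {ι : Type*} [Fintype ι] {κ γ r : ℝ} (hκ : 0 < κ)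
    (hr : 0 ≤ r) (hrγ : r * γ ^ 2 ≤ 1)
    (hint : Integrable (fun x => Real.exp (2 * κ * x ^ 2)) ρ) (s : ℝ) :
    (Measure.pi fun _ : ι => ρ).real {w | s ≤ ∑ i, excess γ (w i)} ≤
      Real.exp (Fintype.card ι * (Real.exp (-(κ * r)) * ∫ x, Real.exp (2 * κ * x ^ 2) ∂ρ)
        - κ * s) := by
  have hm := measurable_excess γ
  refine measureReal_le_of_lintegral_exp_le _ (X := fun w : ι → ℝ => ∑ i, excess γ (w i))
    (by fun_prop) hκ ?_
  have hexp : Integrable (fun x => Real.exp (κ * excess γ x)) ρ := by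
    refine ((integrable_const (1 : ℝ)).add (hint.const_mul (Real.exp (-(κ * r))))).mono'
      (by fun_prop) (ae_of_all _ fun x => ?_)
    rw [Real.norm_of_nonneg (Real.exp_pos _).le]
    exact exp_mul_excess_le hκ hr hrγ x
  have hprod : ∀ w : ι → ℝ, Real.exp (κ * ∑ i, excess γ (w i)) =
      ∏ i, Real.exp (κ * excess γ (w i)) := fun w => by
    rw [Finset.mul_sum, Real.exp_sum]
  simp only [hprod]
  rw [← ofReal_integral_eq_lintegral_ofReal (Integrable.fintype_prod fun _ => hexp)
    (ae_of_all _ fun w => Finset.prod_nonneg fun i _ => (Real.exp_pos _).le),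
    integral_fintype_prod_eq_pow (fun x => Real.exp (κ * excess γ x))]
  refine ENNReal.ofReal_le_ofReal ?_
  rw [Real.exp_nat_mul]
  refine pow_le_pow_left₀ (integral_nonneg fun _ => (Real.exp_pos _).le) ?_ _
  calc _ ≤ ∫ x, (1 + Real.exp (-(κ * r)) * Real.exp (2 * κ * x ^ 2)) ∂ρ :=
        integral_mono hexp ((integrable_const _).add (hint.const_mul _))
          fun x => exp_mul_excess_le hκ hr hrγ x
    _ = 1 + Real.exp (-(κ * r)) * ∫ x, Real.exp (2 * κ * x ^ 2) ∂ρ := by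
        rw [integral_add (integrable_const _) (hint.const_mul _), integral_const_mul]; simp
    _ ≤ _ := by
        linarith [Real.add_one_le_exp
          (Real.exp (-(κ * r)) * ∫ x, Real.exp (2 * κ * x ^ 2) ∂ρ)]

end

/-! ### Measurability and the exact mean. -/

section

variable {V : Type*} [Fintype V] [DecidableEq V] (G : SimpleGraph V) [DecidableRel G.Adj]

/-- A product over the edges at `u` as a product over the neighbours of `u`. -/
theorem prod_incident_edges (A C : G.edgeSet → ℝ) {u v : V} (huv : G.Adj u v) :
    ∏ e : G.edgeSet, (if e.1 = s(u, v) then A e else if u ∈ e.1 then C e else 1) =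
      edgeWeight G A u v * ∏ x ∈ (G.neighborFinset u).erase v, edgeWeight G C u x := by
  rw [← Finset.mul_prod_erase _ _ (Finset.mem_univ (⟨s(u, v), huv⟩ : G.edgeSet)), if_pos rfl]
  congr 1
  · simp [edgeWeight, huv]
  · rw [Finset.prod_congr rfl (g := fun e : G.edgeSet => if u ∈ e.1 then C e else 1) fun e he => by
      rw [if_neg fun h => Finset.ne_of_mem_erase he (Subtype.ext h)]]
    rw [← Finset.prod_filter]
    symm
    refine Finset.prod_bij
      (fun x hx => (⟨s(u, x), by simpa using Finset.mem_of_mem_erase hx⟩ : G.edgeSet)) ?_ ?_ ?_ ?_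
    · intro x hx
      have hxv := Finset.ne_of_mem_erase hx
      simp only [Finset.mem_filter, Finset.mem_erase, Finset.mem_univ, and_true, ne_eq]
      exact ⟨fun h => hxv (Sym2.congr_right.1 (congrArg Subtype.val h)), Sym2.mem_mk_left _ _⟩
    · intro x hx y hy h
      exact Sym2.congr_right.1 (congrArg Subtype.val h)
    · rintro ⟨e, he⟩ hmem
      simp only [Finset.mem_filter, Finset.mem_erase, Finset.mem_univ, and_true, ne_eq] at hmem
      obtain ⟨x, rfl⟩ := Sym2.mem_iff_exists.1 hmem.2
      refine ⟨x, ?_, rfl⟩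
      rw [Finset.mem_erase, SimpleGraph.mem_neighborFinset]
      exact ⟨fun h => hmem.1 (Subtype.ext (congrArg (fun y => s(u, y)) h)), he⟩
    · intro x hx
      have h : G.Adj u x := by simpa using Finset.mem_of_mem_erase hx
      exact dif_pos h

omit [Fintype V] [DecidableEq V] in
theorem measurable_edgeWeight (u v : V) : Measurable fun w : G.edgeSet → ℝ => edgeWeight G w u v := by
  unfold edgeWeight
  split_ifs
  · fun_prop
  · fun_prop

theorem measurable_starEnergy (γ : ℝ) : Measurable fun y : V → ℝ => starEnergy γ y := by
  unfold starEnergy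
  fun_prop

theorem measurable_objective (hG : G.CliqueFree 3) (γ : ℝ) : Measurable (objective G γ) := by
  have : objective G γ = fun w => 1 / 2 * ∑ e, w e + 1 / 4 * ∑ u, starEnergy γ (edgeWeight G w u) :=
    funext fun w => objective_eq G hG γ w
  rw [this]
  have h : ∀ u, Measurable fun w : G.edgeSet → ℝ => starEnergy γ (edgeWeight G w u) := fun u =>
    (measurable_starEnergy γ).comp (measurable_pi_lambda _ fun v => measurable_edgeWeight G u v)
  fun_prop

theorem measurable_truncObjective (γ : ℝ) : Measurable (truncObjective G γ) := by
  unfold truncObjective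
  have ht := measurable_trunc γ
  have h : ∀ u, Measurable fun w : G.edgeSet → ℝ =>
      starEnergy γ (edgeWeight G (fun e => trunc γ (w e)) u) := fun u =>
    (measurable_starEnergy γ).comp (measurable_pi_lambda _ fun v =>
      (measurable_edgeWeight G u v).comp
        (measurable_pi_lambda _ fun e => ht.comp (measurable_pi_apply e)))
  fun_prop

variable {ρ : Measure ℝ} [IsProbabilityMeasure ρ]

theorem integrable_objective (hG : G.CliqueFree 3) (γ : ℝ) (h1 : Integrable (fun x : ℝ => x) ρ) :
    Integrable (objective G γ) (Measure.pi fun _ => ρ) := by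
  refine Integrable.mono' (g := fun w => ∑ e, |w e|) ?_
    (measurable_objective G hG γ).aestronglyMeasurable (ae_of_all _ fun w => abs_objective_le G hG γ w)
  exact integrable_finsetSum _ fun e _ =>
    integrable_comp_eval (μ := fun _ : G.edgeSet => ρ) (i := e) h1.abs

omit [IsProbabilityMeasure ρ] in
theorem integrable_mul_sin (γ : ℝ) (h1 : Integrable (fun x : ℝ => x) ρ) :
    Integrable (fun x => x * Real.sin (γ * x)) ρ := by
  refine h1.norm.mono' (by fun_prop) (ae_of_all _ fun x => ?_)
  rw [norm_mul]
  exact mul_le_of_le_one_right (norm_nonneg _) (Real.abs_sin_le_one _)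

theorem integrable_cos (γ : ℝ) : Integrable (fun x => Real.cos (γ * x)) ρ :=
  (integrable_const (1 : ℝ)).mono' (by fun_prop) (ae_of_all _ fun x => Real.abs_cos_le_one _)

/-- The contribution of an edge to the mean of the objective. -/
theorem integral_star_term (γ : ℝ) (h1 : Integrable (fun x : ℝ => x) ρ) {D : ℕ}
    (hD : G.IsRegularOfDegree (D + 1)) {u v : V} (huv : G.Adj u v) :
    Integrable (fun w : G.edgeSet → ℝ => edgeWeight G w u v * Real.sin (γ * edgeWeight G w u v) *
      ∏ x ∈ Finset.univ.erase v, Real.cos (γ * edgeWeight G w u x)) (Measure.pi fun _ => ρ) ∧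
    ∫ w : G.edgeSet → ℝ, edgeWeight G w u v * Real.sin (γ * edgeWeight G w u v) *
      ∏ x ∈ Finset.univ.erase v, Real.cos (γ * edgeWeight G w u x) ∂(Measure.pi fun _ => ρ) =
      (∫ x, x * Real.sin (γ * x) ∂ρ) * (∫ x, Real.cos (γ * x) ∂ρ) ^ D := by
  -- Each edge at u occurs in exactly one factor; edges away from u get the factor 1, and
  -- non-neighbours of u contribute cos 0 = 1. The integrand becomes a product over all edges and
  -- the integral factors.
  let h : G.edgeSet → ℝ → ℝ := fun e x => if e.1 = s(u, v) then x * Real.sin (γ * x) else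
    if u ∈ e.1 then Real.cos (γ * x) else 1
  have hprod : ∀ w : G.edgeSet → ℝ,
      edgeWeight G w u v * Real.sin (γ * edgeWeight G w u v) *
        ∏ x ∈ Finset.univ.erase v, Real.cos (γ * edgeWeight G w u x) = ∏ e, h e (w e) := by
    intro w
    have := prod_incident_edges G (fun e => w e * Real.sin (γ * w e))
      (fun e => Real.cos (γ * w e)) huv
    simp only [h]
    rw [this, edgeWeight_comp G (fun x => x * Real.sin (γ * x)) (by simp)]
    congr 1
    symm
    refine (Finset.prod_congr rfl fun x hx => ?_).trans (Finset.prod_subset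
      (Finset.erase_subset_erase v (Finset.subset_univ (G.neighborFinset u))) fun x hx hx' => ?_)
    · have hux : G.Adj u x := by simpa using Finset.mem_of_mem_erase hx
      simp [edgeWeight, hux]
    · have hux : ¬ G.Adj u x := fun hux => hx' (Finset.mem_erase.2
        ⟨Finset.ne_of_mem_erase hx, by simpa using hux⟩)
      rw [edgeWeight_of_not_adj G w hux]
      simp
  have hint : ∀ e, Integrable (h e) ρ := by
    intro e
    simp only [h]
    split_ifs
    · exact integrable_mul_sin γ h1
    · exact integrable_cos γ
    · exact integrable_const _
  simp only [hprod]
  refine ⟨Integrable.fintype_prod_dep hint, ?_⟩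
  rw [integral_fintype_prod_eq_prod]
  have hval : ∀ e : G.edgeSet, ∫ x, h e x ∂ρ = if e.1 = s(u, v) then ∫ x, x * Real.sin (γ * x) ∂ρ
      else if u ∈ e.1 then ∫ x, Real.cos (γ * x) ∂ρ else 1 := by
    intro e
    simp only [h]
    split_ifs
    · rfl
    · rfl
    · simp
  simp only [hval]
  rw [prod_incident_edges G (fun _ => ∫ x, x * Real.sin (γ * x) ∂ρ)
    (fun _ => ∫ x, Real.cos (γ * x) ∂ρ) huv]
  congr 1
  · exact dif_pos huv
  · rw [Finset.prod_congr rfl (g := fun _ => ∫ x, Real.cos (γ * x) ∂ρ) fun x hx => ?_,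
      Finset.prod_const, Finset.card_erase_of_mem (by simpa using huv)]
    · have : (G.neighborFinset u).card = D + 1 := hD u
      rw [this, Nat.add_sub_cancel]
    · have hux : G.Adj u x := by simpa using Finset.mem_of_mem_erase hx
      exact dif_pos hux

theorem two_mul_card_edgeSet {d : ℕ} (hd : G.IsRegularOfDegree d) :
    2 * (Fintype.card G.edgeSet : ℝ) = Fintype.card V * d := by
  have h := sum_sum_edgeWeight G (fun _ => 1)
  have h2 : ∀ u, ∑ v, edgeWeight G (fun _ => 1) u v = d := by
    intro u
    have : (G.neighborFinset u).card = d := hd u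
    rw [← this, SimpleGraph.neighborFinset_eq_filter, ← Finset.sum_boole]
    rfl
  simp only [h2] at h
  simpa using h.symm

/-- The mean of the objective. -/
theorem integral_objective (hG : G.CliqueFree 3) (γ : ℝ) (h1 : Integrable (fun x : ℝ => x) ρ)
    {D : ℕ} (hD : G.IsRegularOfDegree (D + 1)) :
    ∫ w, objective G γ w ∂(Measure.pi fun _ => ρ) = Fintype.card V * (D + 1) / 4 *
      (∫ x, x ∂ρ + (∫ x, x * Real.sin (γ * x) ∂ρ) * (∫ x, Real.cos (γ * x) ∂ρ) ^ D) := by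
  set m := (∫ x, x * Real.sin (γ * x) ∂ρ) * (∫ x, Real.cos (γ * x) ∂ρ) ^ D with hm
  set P : Measure (G.edgeSet → ℝ) := Measure.pi fun _ => ρ with hP
  have hterm : ∀ u v, Integrable (fun w : G.edgeSet → ℝ =>
      edgeWeight G w u v * Real.sin (γ * edgeWeight G w u v) *
      ∏ x ∈ Finset.univ.erase v, Real.cos (γ * edgeWeight G w u x)) P ∧
      ∫ w : G.edgeSet → ℝ, edgeWeight G w u v * Real.sin (γ * edgeWeight G w u v) *
      ∏ x ∈ Finset.univ.erase v, Real.cos (γ * edgeWeight G w u x) ∂P =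
      edgeWeight G (fun _ => m) u v := by
    intro u v
    by_cases huv : G.Adj u v
    · have := integral_star_term G γ h1 hD huv
      refine ⟨this.1, this.2.trans ?_⟩
      exact (dif_pos huv : edgeWeight G (fun _ => m) u v = m).symm
    · simp only [edgeWeight_of_not_adj G _ huv]
      simp
  have hlin : ∀ e : G.edgeSet, Integrable (fun w : G.edgeSet → ℝ => w e) P := fun e =>
    integrable_comp_eval (μ := fun _ : G.edgeSet => ρ) (i := e) h1
  have hlinv : ∀ e : G.edgeSet, ∫ w : G.edgeSet → ℝ, w e ∂P = ∫ x, x ∂ρ := fun e =>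
    integral_comp_eval (μ := fun _ : G.edgeSet => ρ) (i := e) (f := fun x : ℝ => x)
      (by fun_prop)
  have hstar : ∀ u, Integrable (fun w : G.edgeSet → ℝ => starEnergy γ (edgeWeight G w u)) P :=
    fun u => integrable_finsetSum _ fun v _ => (hterm u v).1
  simp only [objective_eq G hG]
  rw [integral_add ((integrable_finsetSum _ fun e _ => hlin e).const_mul _)
    ((integrable_finsetSum _ fun u _ => hstar u).const_mul _), integral_const_mul,
    integral_const_mul, integral_finsetSum _ fun e _ => hlin e,
    integral_finsetSum _ fun u _ => hstar u]
  have : ∀ u, ∫ w, starEnergy γ (edgeWeight G w u) ∂P = ∑ v, edgeWeight G (fun _ => m) u v := by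
    intro u
    unfold starEnergy
    rw [integral_finsetSum _ fun v _ => (hterm u v).1]
    exact Finset.sum_congr rfl fun v _ => (hterm u v).2
  simp only [this, hlinv, sum_sum_edgeWeight]
  simp only [Finset.sum_const, Finset.card_univ, nsmul_eq_mul]
  have hc := two_mul_card_edgeSet G hD
  push_cast at hc
  linear_combination ((∫ x, x ∂ρ) / 4 + m / 4) * hc

end

/-! ### Lower bound for the mean per edge. -/

/-- The coefficient 2 makes the bound global, so it can be integrated: for |x| > 1 the left side is
at most -x², hence below -|x|. -/
theorem sq_sub_le_mul_sin (x : ℝ) : x ^ 2 - 2 * x ^ 4 ≤ x * Real.sin x := by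
  have key : ∀ y : ℝ, 0 ≤ y → y ^ 2 - 2 * y ^ 4 ≤ y * Real.sin y := by
    intro y hy
    rcases hy.eq_or_lt with rfl | hy
    · simp
    rcases le_or_gt y 1 with h1 | h1
    · have h2 := Real.sin_gt_sub_cube hy
      nlinarith [pow_pos hy 2, pow_pos hy 3, pow_pos hy 4]
    · have h2 := Real.neg_one_le_sin y
      have h3 : y ^ 2 ≤ y ^ 4 := pow_le_pow_right₀ h1.le (by norm_num)
      nlinarith
  have h := key |x| (abs_nonneg x)
  rcases abs_cases x with ⟨hx, _⟩ | ⟨hx, _⟩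
  · rwa [hx] at h
  · rw [hx, Real.sin_neg] at h
    nlinarith

section

variable {ρ : Measure ℝ} [IsProbabilityMeasure ρ]

/-- The mean edge energy is bounded below by a multiple of `D ^ (-1/2)`. -/
theorem eventually_edge_mean_ge {c₁ c₂ : ℝ} (hc₁ : 0 < c₁) (h1 : Integrable (fun x : ℝ => x) ρ)
    (h2 : Integrable (fun x : ℝ => x ^ 2) ρ) (h4 : Integrable (fun x : ℝ => x ^ 4) ρ)
    (hpos : 0 < ∫ x, x ^ 2 ∂ρ) :
    ∃ c : ℝ, 0 < c ∧ ∀ᶠ D : ℕ in atTop, ∀ γ : ℝ, c₁ / Real.sqrt D ≤ |γ| →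
      |γ| ≤ c₂ / Real.sqrt D → c / Real.sqrt D ≤
        |∫ x, x ∂ρ + (∫ x, x * Real.sin (γ * x) ∂ρ) * (∫ x, Real.cos (γ * x) ∂ρ) ^ D| := by
  set S := ∫ x, x ^ 2 ∂ρ with hS
  set Q := ∫ x, x ^ 4 ∂ρ with hQ
  have hQ0 : 0 ≤ Q := integral_nonneg fun x => by positivity
  have hsqrt : Tendsto (fun D : ℕ => Real.sqrt D) atTop atTop :=
    Real.tendsto_sqrt_atTop.comp tendsto_natCast_atTop_atTop
  have hcos1 : ∀ γ : ℝ, |∫ x, Real.cos (γ * x) ∂ρ| ≤ 1 := by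
    intro γ
    have := norm_integral_le_of_norm_le_const (μ := ρ) (f := fun x => Real.cos (γ * x)) (C := 1)
      (ae_of_all _ fun x => Real.abs_cos_le_one _)
    simpa using this
  -- For centred weights the nonlinear term is the whole mean: E[x sin γx] is at least |γ|S/2 in
  -- size and (E cos γx)^D stays above exp(-b)/2. Otherwise the nonlinear term is O(1/√D), the mean
  -- weight dominates, and the bound is even of order 1.
  by_cases hμ : ∫ x, x ∂ρ = 0
  · set b := c₂ ^ 2 * S / 2 with hb
    refine ⟨c₁ * S / 2 * (Real.exp (-b) / 2), by positivity, ?_⟩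
    have hlim := Real.tendsto_one_add_div_pow_exp (-b)
    have e1 : ∀ᶠ D : ℕ in atTop, Real.exp (-b) / 2 < (1 + -b / D) ^ D :=
      hlim.eventually_const_lt (by linarith [Real.exp_pos (-b)])
    have e2 : ∀ᶠ D : ℕ in atTop, 4 * c₂ ^ 2 * Q / S ≤ D :=
      tendsto_natCast_atTop_atTop.eventually_ge_atTop _
    have e3 : ∀ᶠ D : ℕ in atTop, b ≤ D := tendsto_natCast_atTop_atTop.eventually_ge_atTop _
    filter_upwards [e1, e2, e3, eventually_gt_atTop 0] with D hD1 hD2 hD3 hD0 γ hγ1 hγ2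
    have hDpos : (0 : ℝ) < D := by exact_mod_cast hD0
    have hsD : 0 < Real.sqrt D := Real.sqrt_pos.2 hDpos
    have hγpos : 0 < |γ| := (div_pos hc₁ hsD).trans_le hγ1
    have hγsq : γ ^ 2 * D ≤ c₂ ^ 2 := by
      have := (le_div_iff₀ hsD).1 hγ2
      calc γ ^ 2 * D = (|γ| * Real.sqrt D) ^ 2 := by
            rw [mul_pow, sq_abs, Real.sq_sqrt hDpos.le]
        _ ≤ c₂ ^ 2 := by gcongr
    rw [hμ, zero_add, abs_mul]
    have hm : |γ| * (S / 2) ≤ |∫ x, x * Real.sin (γ * x) ∂ρ| := by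
      have hint := integrable_mul_sin γ h1
      have hle : γ ^ 2 * S - 2 * γ ^ 4 * Q ≤ γ * ∫ x, x * Real.sin (γ * x) ∂ρ := by
        rw [hS, hQ, ← integral_const_mul, ← integral_const_mul, ← integral_const_mul,
          ← integral_sub (h2.const_mul _) (h4.const_mul _)]
        refine integral_mono ((h2.const_mul _).sub (h4.const_mul _)) (hint.const_mul _) fun x => ?_
        have := sq_sub_le_mul_sin (γ * x)
        simp only
        calc _ = (γ * x) ^ 2 - 2 * (γ * x) ^ 4 := by ring
          _ ≤ _ := this
          _ = _ := by ring
      have h5 : 2 * γ ^ 2 * Q ≤ S / 2 := by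
        have h6 : 4 * c₂ ^ 2 * Q ≤ D * S := (div_le_iff₀ hpos).1 hD2
        have h7 : γ ^ 2 * D * Q ≤ c₂ ^ 2 * Q := by gcongr
        have h8 : D * (2 * γ ^ 2 * Q) ≤ D * (S / 2) := by linarith
        exact le_of_mul_le_mul_left h8 hDpos
      have h9 : γ ^ 2 * (S / 2) ≤ |γ| * |∫ x, x * Real.sin (γ * x) ∂ρ| := by
        rw [← abs_mul]
        refine le_trans ?_ (le_abs_self _)
        nlinarith [mul_le_mul_of_nonneg_left h5 (sq_nonneg γ)]
      rw [← sq_abs, sq, mul_assoc] at h9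
      exact le_of_mul_le_mul_left h9 hγpos
    have hq : Real.exp (-b) / 2 ≤ |(∫ x, Real.cos (γ * x) ∂ρ) ^ D| := by
      have hle : 1 - γ ^ 2 / 2 * S ≤ ∫ x, Real.cos (γ * x) ∂ρ := by
        have : 1 - γ ^ 2 / 2 * S = ∫ x, (1 - γ ^ 2 / 2 * x ^ 2) ∂ρ := by
          rw [integral_sub (integrable_const _) (h2.const_mul _), integral_const_mul]; simp [hS]
        rw [this]
        refine integral_mono ((integrable_const _).sub (h2.const_mul _)) (integrable_cos γ)
          fun x => ?_
        have := Real.one_sub_sq_div_two_le_cos (x := γ * x)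
        simp only
        linarith [mul_pow γ x 2]
      have h5 : 1 + -b / D ≤ 1 - γ ^ 2 / 2 * S := by
        have : γ ^ 2 / 2 * S ≤ b / D := by
          rw [le_div_iff₀ hDpos, hb]
          nlinarith [mul_le_mul_of_nonneg_right hγsq hpos.le]
        rw [neg_div]; linarith
      have h6 : 0 ≤ 1 + -b / D := by
        have : b / D ≤ 1 := div_le_one_of_le₀ hD3 hDpos.le
        rw [neg_div]; linarith
      refine hD1.le.trans (le_trans ?_ (le_abs_self _))
      exact pow_le_pow_left₀ h6 (h5.trans hle) D
    calc c₁ * S / 2 * (Real.exp (-b) / 2) / Real.sqrt D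
        = (c₁ / Real.sqrt D) * (S / 2) * (Real.exp (-b) / 2) := by ring
      _ ≤ |γ| * (S / 2) * (Real.exp (-b) / 2) := by gcongr
      _ ≤ _ := by gcongr
  · set μ := ∫ x, x ∂ρ with hμdef
    have hμpos : 0 < |μ| := abs_pos.2 hμ
    refine ⟨|μ| / 2, by positivity, ?_⟩
    have e1 : ∀ᶠ D : ℕ in atTop, 2 * c₂ * S / |μ| ≤ Real.sqrt D := hsqrt.eventually_ge_atTop _
    have e2 : ∀ᶠ D : ℕ in atTop, 1 ≤ Real.sqrt D := hsqrt.eventually_ge_atTop _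
    filter_upwards [e1, e2] with D hD1 hD2 γ hγ1 hγ2
    have hsD : 0 < Real.sqrt D := by linarith
    have hm : |∫ x, x * Real.sin (γ * x) ∂ρ| ≤ |γ| * S := by
      rw [hS, ← integral_const_mul]
      refine (abs_integral_le_integral_abs).trans (integral_mono (integrable_mul_sin γ h1).abs
        (h2.const_mul _) fun x => abs_mul_sin_le γ x)
    have hp : |(∫ x, x * Real.sin (γ * x) ∂ρ) * (∫ x, Real.cos (γ * x) ∂ρ) ^ D| ≤ |μ| / 2 := by
      rw [abs_mul, abs_pow]
      calc _ ≤ |γ| * S * 1 := by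
            gcongr
            exact pow_le_one₀ (abs_nonneg _) (hcos1 γ)
        _ ≤ c₂ / Real.sqrt D * S := by rw [mul_one]; gcongr
        _ ≤ |μ| / 2 := by
            rw [div_mul_eq_mul_div, div_le_iff₀ hsD]
            have := (div_le_iff₀ hμpos).1 hD1
            linarith
    have h3 : |μ| / 2 / Real.sqrt D ≤ |μ| / 2 := div_le_self (by positivity) hD2
    have h5 := abs_sub_abs_le_abs_sub μ
      (-((∫ x, x * Real.sin (γ * x) ∂ρ) * (∫ x, Real.cos (γ * x) ∂ρ) ^ D))
    rw [abs_neg, sub_neg_eq_add] at h5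
    linarith

end

/-! ### Deviation bounds at scale N√D. -/

section

variable {ρ : Measure ℝ} [IsProbabilityMeasure ρ]

theorem integrable_pow_of_exp_sq {κ : ℝ} (hκ : 0 < κ)
    (hint : Integrable (fun x => Real.exp (2 * κ * x ^ 2)) ρ) :
    Integrable (fun x : ℝ => x) ρ ∧ Integrable (fun x : ℝ => x ^ 2) ρ ∧
      Integrable (fun x : ℝ => x ^ 4) ρ := by
  have hbase : ∀ x : ℝ, 2 * κ * x ^ 2 + 1 ≤ Real.exp (2 * κ * x ^ 2) := fun x =>
    Real.add_one_le_exp _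
  have h2 : Integrable (fun x : ℝ => x ^ 2) ρ := by
    refine (hint.div_const (2 * κ)).mono' (by fun_prop) (ae_of_all _ fun x => ?_)
    rw [Real.norm_of_nonneg (sq_nonneg x), le_div_iff₀ (by positivity)]
    linarith [hbase x]
  refine ⟨?_, h2, ?_⟩
  · refine ((integrable_const (1 : ℝ)).add h2).mono' (by fun_prop) (ae_of_all _ fun x => ?_)
    rw [Real.norm_eq_abs, abs_le]
    simp only [Pi.add_apply]
    constructor <;> nlinarith [sq_nonneg (x + 1), sq_nonneg (x - 1)]
  · refine (hint.const_mul (2 / (2 * κ) ^ 2)).mono' (by fun_prop) (ae_of_all _ fun x => ?_)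
    rw [Real.norm_of_nonneg (by positivity), div_mul_eq_mul_div, le_div_iff₀ (by positivity)]
    have := Real.quadratic_le_exp_of_nonneg (x := 2 * κ * x ^ 2) (by positivity)
    nlinarith [sq_nonneg x]

/-- The exponential rate in `measureReal_objective_deviation_le`. -/
noncomputable def deviationRate (ρ : Measure ℝ) (κ c₂ c ε : ℝ) : ℝ :=
  min (κ * ε * c / (12 * c₂))
    (min 1 (κ / (1 + 3 * c₂) * ε * c /
      (6 * (varianceProxy ρ (fun x => κ * (1 + x ^ 2)) + 1))) *
      (κ / (1 + 3 * c₂) * ε * c / 6))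

omit [IsProbabilityMeasure ρ] in
theorem deviationRate_pos {κ c₂ c ε : ℝ} (hκ : 0 < κ) (hc₂ : 0 < c₂) (hc : 0 < c) (hε : 0 < ε) :
    0 < deviationRate ρ κ c₂ c ε := by
  have hM : 0 ≤ varianceProxy ρ (fun x => κ * (1 + x ^ 2)) := varianceProxy_nonneg
  unfold deviationRate
  positivity

variable {V : Type*} [Fintype V] [DecidableEq V] (G : SimpleGraph V) [DecidableRel G.Adj]

/-- Concentration of the truncated objective. -/
theorem measureReal_truncObjective_deviation_le {κ c₂ c ε γ : ℝ} (hκ : 0 < κ) (hc₂ : 0 < c₂)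
    (hc : 0 < c) (hε : 0 < ε)
    (hint : Integrable (fun x => Real.exp (2 * κ * x ^ 2)) ρ) {D : ℕ} (hD : 1 ≤ D)
    (hreg : G.IsRegularOfDegree (D + 1)) (hγ : |γ| ≤ c₂) :
    Integrable (truncObjective G γ) (Measure.pi fun _ => ρ) ∧
    (Measure.pi fun _ : G.edgeSet => ρ).real
      {w | ε * c * Fintype.card V * Real.sqrt D / 3 ≤ |truncObjective G γ w -
        ∫ w', truncObjective G γ w' ∂(Measure.pi fun _ => ρ)|} ≤
      2 * Real.exp (-(Fintype.card V * deviationRate ρ κ c₂ c ε)) := by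
  set N : ℝ := ((Fintype.card V : ℕ) : ℝ) with hN
  have hN0 : 0 ≤ N := Nat.cast_nonneg _
  -- Rescaling by `s₀` brings the oscillation down to κ(1 + x²), for which exp(2g) is integrable by
  -- `hint`.
  set s₀ := κ / (1 + 3 * c₂) with hs₀
  have hs₀pos : 0 < s₀ := by positivity
  set g : ℝ → ℝ := fun x => κ * (1 + x ^ 2) with hgdef
  set M := varianceProxy ρ g with hM
  have hM0 : 0 ≤ M := varianceProxy_nonneg
  set P : Measure (G.edgeSet → ℝ) := Measure.pi fun _ => ρ with hP
  have hgm : Measurable g := by fun_prop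
  have hg0 : ∀ x, 0 ≤ g x := fun x => by positivity
  have hg : Integrable (fun x => Real.exp (2 * g x)) ρ := by
    have : (fun x => Real.exp (2 * g x)) =
        fun x => Real.exp (2 * κ) * Real.exp (2 * κ * x ^ 2) := by
      ext x; rw [← Real.exp_add]; congr 1; simp only [hgdef]; ring
    rw [this]
    exact hint.const_mul _
  set f : (G.edgeSet → ℝ) → ℝ := fun w => s₀ * truncObjective G γ w with hf
  have hfm : Measurable f := (measurable_truncObjective G γ).const_mul _
  have hosc : ∀ w i a b, |f (Function.update w i a) - f (Function.update w i b)| ≤ g a + g b := by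
    intro w i a b
    have h1 := abs_truncObjective_update_sub_le G γ w i a b
    have h2 : ∀ x : ℝ, s₀ * ((1 + 3 * |γ|) * (1 + x ^ 2)) ≤ g x := by
      intro x
      calc s₀ * ((1 + 3 * |γ|) * (1 + x ^ 2)) ≤ s₀ * ((1 + 3 * c₂) * (1 + x ^ 2)) := by gcongr
        _ = g x := by simp only [hs₀, hgdef]; field_simp
    simp only [hf]
    rw [← mul_sub, abs_mul, abs_of_pos hs₀pos]
    calc _ ≤ s₀ * ((1 + 3 * |γ|) * (1 + a ^ 2) + (1 + 3 * |γ|) * (1 + b ^ 2)) := by gcongr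
      _ ≤ g a + g b := by rw [mul_add]; exact add_le_add (h2 a) (h2 b)
  have hfi := integrable_pi_of_oscillation (ι := G.edgeSet) hgm hg0 hg hfm hosc
  have hXi : Integrable (truncObjective G γ) P := by
    have := hfi.const_mul s₀⁻¹
    simpa only [hf, inv_mul_cancel_left₀ hs₀pos.ne'] using this
  refine ⟨hXi, ?_⟩
  -- The Chernoff parameter is t = a/√D. With at most ND edges, the variance term is at most N a² M,
  -- and this choice of `a` makes it at most half of the linear gain t·s; the other half is the
  -- rate.
  set a := min 1 (s₀ * ε * c / (6 * (M + 1))) with ha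
  have hapos : 0 < a := lt_min one_pos (by positivity)
  have haM : a * M ≤ s₀ * ε * c / 6 := by
    calc a * M ≤ s₀ * ε * c / (6 * (M + 1)) * (M + 1) := by
          gcongr
          · exact min_le_right _ _
          · linarith
      _ = s₀ * ε * c / 6 := by field_simp
  have hDR : (1 : ℝ) ≤ D := by exact_mod_cast hD
  have hsD : 1 ≤ Real.sqrt D := Real.one_le_sqrt.2 hDR
  have hsD0 : 0 < Real.sqrt D := by linarith
  have ht0 : 0 < a / Real.sqrt D := by positivity
  have ht1 : a / Real.sqrt D ≤ 1 := div_le_one_of_le₀ ((min_le_left _ _).trans hsD) hsD0.le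
  have hconc := measureReal_abs_sub_integral_ge_le (ι := G.edgeSet) hgm hg0 hg ht0 ht1 hfm hosc
    (s₀ * (ε * c * N * Real.sqrt D / 3))
  have hset : {w | ε * c * N * Real.sqrt D / 3 ≤ |truncObjective G γ w -
        ∫ w', truncObjective G γ w' ∂P|} =
      {w | s₀ * (ε * c * N * Real.sqrt D / 3) ≤ |f w - ∫ w', f w' ∂P|} := by
    ext w
    simp only [Set.mem_ofPred_eq, hf]
    rw [integral_const_mul, ← mul_sub, abs_mul, abs_of_pos hs₀pos, mul_le_mul_iff_right₀ hs₀pos]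
  rw [hset]
  refine hconc.trans ?_
  gcongr
  have hcard : (Fintype.card G.edgeSet : ℝ) ≤ N * D := by
    have := two_mul_card_edgeSet G hreg
    push_cast at this
    nlinarith
  have hsq : (a / Real.sqrt D) ^ 2 * D = a ^ 2 := by
    rw [div_pow, Real.sq_sqrt (by linarith)]; field_simp
  have h1 : (Fintype.card G.edgeSet : ℝ) * ((a / Real.sqrt D) ^ 2 * M) ≤ N * (a * (s₀ * ε * c / 6)) := by
    calc _ ≤ (N * D) * ((a / Real.sqrt D) ^ 2 * M) := by gcongr
      _ = N * (((a / Real.sqrt D) ^ 2 * D) * M) := by ring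
      _ = N * (a * (a * M)) := by rw [hsq]; ring
      _ ≤ _ := by gcongr
  have h2 : a / Real.sqrt D * (s₀ * (ε * c * N * Real.sqrt D / 3)) = 2 * (N * (a * (s₀ * ε * c / 6))) := by
    field_simp
    ring
  have h3 : N * deviationRate ρ κ c₂ c ε ≤ N * (a * (s₀ * ε * c / 6)) := by
    gcongr
    exact min_le_right _ _
  linarith

/-- Concentration of the objective at scale `N √D`. -/
theorem measureReal_objective_deviation_le {κ c₂ c ε γ : ℝ} (hκ : 0 < κ) (hc₂ : 0 < c₂)
    (hc : 0 < c) (hε : 0 < ε)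
    (hint : Integrable (fun x => Real.exp (2 * κ * x ^ 2)) ρ) {D : ℕ} (hD : 2 ≤ D)
    (hsmall : D * (Real.exp (-(κ * (D / c₂ ^ 2))) * ∫ x, Real.exp (2 * κ * x ^ 2) ∂ρ) ≤
      κ * ε * c / (12 * c₂))
    (hG : G.CliqueFree 3) (hreg : G.IsRegularOfDegree (D + 1)) (hγ : |γ| ≤ c₂ / Real.sqrt D) :
    (Measure.pi fun _ : G.edgeSet => ρ).real
      {w | ε * c * Fintype.card V * Real.sqrt D ≤ |objective G γ w -
        ∫ w', objective G γ w' ∂(Measure.pi fun _ => ρ)|} ≤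
      3 * Real.exp (-(Fintype.card V * deviationRate ρ κ c₂ c ε)) := by
  have hDR : (2 : ℝ) ≤ D := by exact_mod_cast hD
  have hDpos : (0 : ℝ) < D := by linarith
  have hsD : 1 ≤ Real.sqrt D := Real.one_le_sqrt.2 (by linarith)
  have hsD0 : 0 < Real.sqrt D := by linarith
  have hγ' : |γ| ≤ c₂ := hγ.trans (div_le_self hc₂.le hsD)
  obtain ⟨hXi, hconc⟩ := measureReal_truncObjective_deviation_le G hκ hc₂ hc hε hint
    (by omega : 1 ≤ D) hreg hγ'
  set N : ℝ := ((Fintype.card V : ℕ) : ℝ) with hN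
  have hN0 : 0 ≤ N := Nat.cast_nonneg _
  set P : Measure (G.edgeSet → ℝ) := Measure.pi fun _ => ρ with hP
  -- Since |γ| ≤ c₂/√D, a weight with |γx| > 1 has x² ≥ D/c₂².
  set r : ℝ := D / c₂ ^ 2 with hr
  have hr0 : 0 ≤ r := by positivity
  have hrγ : r * γ ^ 2 ≤ 1 := by
    have h1 : γ ^ 2 * D ≤ c₂ ^ 2 := by
      have := (le_div_iff₀ hsD0).1 hγ
      calc γ ^ 2 * D = (|γ| * Real.sqrt D) ^ 2 := by
            rw [mul_pow, sq_abs, Real.sq_sqrt hDpos.le]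
        _ ≤ c₂ ^ 2 := by gcongr
    rw [hr, div_mul_eq_mul_div, mul_comm]
    exact div_le_one_of_le₀ h1 (by positivity)
  set b := Real.exp (-(κ * r)) * ∫ x, Real.exp (2 * κ * x ^ 2) ∂ρ with hb
  have hb0 : 0 ≤ b := mul_nonneg (Real.exp_pos _).le (integral_nonneg fun _ => (Real.exp_pos _).le)
  have hcard : (Fintype.card G.edgeSet : ℝ) ≤ N * D := by
    have := two_mul_card_edgeSet G hreg
    push_cast at this
    nlinarith
  -- The degree is D + 1, so the factor is D + 2, which is at most 2D because D ≥ 2.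
  have hcoef : |γ| * ((D + 1 : ℕ) + 1) ≤ 2 * c₂ * Real.sqrt D := by
    push_cast
    calc |γ| * (D + 1 + 1 : ℝ) ≤ c₂ / Real.sqrt D * (2 * D) := by gcongr; linarith
      _ = 2 * c₂ * (D / Real.sqrt D) := by ring
      _ = 2 * c₂ * Real.sqrt D := by rw [Real.div_sqrt]
  have hdiff : ∀ w, |objective G γ w - truncObjective G γ w| ≤
      2 * c₂ * Real.sqrt D * ∑ e, excess γ (w e) := fun w =>
    (abs_objective_sub_truncObjective_le G hG hreg γ w).trans (by
      have : 0 ≤ ∑ e, excess γ (w e) := Finset.sum_nonneg fun e _ => excess_nonneg _ _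
      gcongr)
  obtain ⟨h1, -, -⟩ := integrable_pow_of_exp_sq hκ hint
  have hOi : Integrable (objective G γ) P := integrable_objective G hG γ h1
  have hexi : ∀ e : G.edgeSet, Integrable (fun w : G.edgeSet → ℝ => excess γ (w e)) P := fun e =>
    integrable_comp_eval (μ := fun _ : G.edgeSet => ρ) (i := e) (integrable_excess hκ hint γ)
  have hexv : ∀ e : G.edgeSet, ∫ w : G.edgeSet → ℝ, excess γ (w e) ∂P = ∫ x, excess γ x ∂ρ :=
    fun e => integral_comp_eval (μ := fun _ : G.edgeSet => ρ) (i := e) (f := excess γ)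
      (measurable_excess γ).aestronglyMeasurable
  have hmean : |∫ w, objective G γ w ∂P - ∫ w, truncObjective G γ w ∂P| ≤
      ε * c * N * Real.sqrt D / 3 := by
    rw [← integral_sub hOi hXi]
    calc _ ≤ ∫ w, |objective G γ w - truncObjective G γ w| ∂P := abs_integral_le_integral_abs
      _ ≤ ∫ w, 2 * c₂ * Real.sqrt D * ∑ e, excess γ (w e) ∂P :=
          integral_mono (hOi.sub hXi).abs
            ((integrable_finsetSum _ fun e _ => hexi e).const_mul _) hdiff
      _ = 2 * c₂ * Real.sqrt D * (Fintype.card G.edgeSet * ∫ x, excess γ x ∂ρ) := by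
          rw [integral_const_mul, integral_finsetSum _ fun e _ => hexi e]
          simp [hexv]
      _ ≤ 2 * c₂ * Real.sqrt D * (N * D * (b / κ)) := by
          have hex0 : 0 ≤ ∫ x, excess γ x ∂ρ := integral_nonneg fun x => excess_nonneg γ x
          gcongr
          rw [le_div_iff₀ hκ, mul_comm]
          exact integral_excess_le hκ hr0 hrγ hint
      _ = 2 * c₂ * Real.sqrt D * N * (D * b) / κ := by ring
      _ ≤ 2 * c₂ * Real.sqrt D * N * (κ * ε * c / (12 * c₂)) / κ := by gcongr
      _ = ε * c * N * Real.sqrt D / 6 := by field_simp; ring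
      _ ≤ _ := by
          have : 0 ≤ ε * c * N * Real.sqrt D := by positivity
          linarith
  have hexc := measureReal_sum_excess_ge_le (ρ := ρ) (ι := G.edgeSet) hκ hr0 hrγ hint
    (ε * c * N / (6 * c₂))
  have hexc' : P.real {w | ε * c * N / (6 * c₂) ≤ ∑ e, excess γ (w e)} ≤
      Real.exp (-(N * deviationRate ρ κ c₂ c ε)) := by
    refine hexc.trans ?_
    rw [Real.exp_le_exp]
    have h2 : (Fintype.card G.edgeSet : ℝ) * b ≤ N * (κ * ε * c / (12 * c₂)) := by
      calc _ ≤ N * D * b := by gcongr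
        _ = N * (D * b) := by ring
        _ ≤ _ := by gcongr
    have h3 : N * deviationRate ρ κ c₂ c ε ≤ N * (κ * ε * c / (12 * c₂)) := by
      gcongr
      exact min_le_left _ _
    have h4 : κ * (ε * c * N / (6 * c₂)) = 2 * (N * (κ * ε * c / (12 * c₂))) := by
      field_simp; ring
    linarith
  -- The deviation is split into thirds: fluctuation of the truncated objective, pathwise truncation
  -- error, and shift of the mean. The last is deterministic; the other two cost 2 and 1
  -- exponentials.
  have hsub : {w | ε * c * N * Real.sqrt D ≤ |objective G γ w - ∫ w', objective G γ w' ∂P|} ⊆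
      {w | ε * c * N * Real.sqrt D / 3 ≤ |truncObjective G γ w -
        ∫ w', truncObjective G γ w' ∂P|} ∪
      {w | ε * c * N / (6 * c₂) ≤ ∑ e, excess γ (w e)} := by
    intro w hw
    by_contra hnot
    simp only [Set.mem_union, Set.mem_ofPred_eq, not_or, not_le] at hw hnot
    have h2 : |objective G γ w - truncObjective G γ w| < ε * c * N * Real.sqrt D / 3 := by
      refine (hdiff w).trans_lt ?_
      calc _ < 2 * c₂ * Real.sqrt D * (ε * c * N / (6 * c₂)) := by
            have := hnot.2
            gcongr
        _ = _ := by field_simp; ring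
    have h3 := abs_add_le (objective G γ w - truncObjective G γ w)
      (truncObjective G γ w - ∫ w', truncObjective G γ w' ∂P)
    have h4 := abs_sub (objective G γ w - ∫ w', truncObjective G γ w' ∂P)
      (∫ w', objective G γ w' ∂P - ∫ w', truncObjective G γ w' ∂P)
    rw [sub_sub_sub_cancel_right] at h4
    rw [sub_add_sub_cancel] at h3
    linarith [hnot.1]
  calc _ ≤ _ := measureReal_mono hsub
    _ ≤ _ := measureReal_union_le _ _
    _ ≤ _ := by linarith

omit [DecidableEq V] in
theorem lt_card_of_isRegularOfDegree [Nonempty V] {d : ℕ} (hd : G.IsRegularOfDegree d) :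
    d < Fintype.card V := by
  obtain ⟨v⟩ := ‹Nonempty V›
  rw [← hd v]
  exact G.degree_lt_card_verts v

end

/-! ### Asymptotics in D and the conclusion. -/

theorem eventually_mul_exp_neg_le {a B η : ℝ} (ha : 0 < a) (hη : 0 < η) :
    ∀ᶠ D : ℕ in atTop, D * (Real.exp (-(a * D)) * B) ≤ η := by
  have h1 := (Real.tendsto_pow_mul_exp_neg_atTop_nhds_zero 1).comp
    (tendsto_natCast_atTop_atTop.const_mul_atTop ha : Tendsto (fun D : ℕ => a * (D : ℝ)) atTop atTop)
  have h2 := h1.const_mul (B / a)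
  rw [mul_zero] at h2
  filter_upwards [h2.eventually_le_const hη] with D hD
  refine le_trans (le_of_eq ?_) hD
  simp only [Function.comp_apply, pow_one]
  field_simp

/-- For large D, half of the exponent Dη covers εD/log D; the other half is at least 1 and turns 3
into 2, since 3 ≤ 2e. -/
theorem eventually_three_mul_exp_le {ε η : ℝ} (hη : 0 < η) :
    ∀ᶠ D : ℕ in atTop, 3 * Real.exp (-(D * η)) ≤ 2 * Real.exp (-(ε * D) / Real.log D) := by
  have hlog : Tendsto (fun D : ℕ => Real.log D) atTop atTop :=
    Real.tendsto_log_atTop.comp tendsto_natCast_atTop_atTop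
  filter_upwards [hlog.eventually_ge_atTop (2 * ε / η), hlog.eventually_gt_atTop 0,
    tendsto_natCast_atTop_atTop.eventually_ge_atTop (2 / η)] with D h1 h2 h3
  have h4 : 2 ≤ D * η := (div_le_iff₀ hη).1 h3
  have hD0 : (0 : ℝ) ≤ D := Nat.cast_nonneg _
  have h5 : ε * D / Real.log D ≤ D * η / 2 := by
    rw [div_le_iff₀ h2]
    have := (div_le_iff₀ hη).1 h1
    nlinarith
  have h6 : (3 : ℝ) ≤ 2 * Real.exp 1 := by linarith [Real.add_one_le_exp (1 : ℝ), Real.exp_one_gt_d9]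
  calc 3 * Real.exp (-(D * η)) ≤ 2 * Real.exp 1 * Real.exp (-(D * η)) := by gcongr
    _ = 2 * Real.exp (1 + -(D * η)) := by rw [mul_assoc, ← Real.exp_add]
    _ ≤ _ := by
        gcongr
        rw [neg_div]
        linarith

theorem integral_sq_gaussianReal_pos (μ : ℝ) {v : ℝ≥0} (hv : 0 < v) :
    0 < ∫ x, x ^ 2 ∂(gaussianReal μ v) := by
  have h := variance_eq_sub (μ := gaussianReal μ v) (X := id) (memLp_id_gaussianReal 2)
  rw [variance_id_gaussianReal] at h
  have h2 : (0 : ℝ) < v := hv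
  have h3 : ∫ x, x ^ 2 ∂(gaussianReal μ v) = v + (∫ x, id x ∂(gaussianReal μ v)) ^ 2 := by
    rw [h]; simp
  rw [h3]
  positivity

end QAOA

theorem theorem5 (μ : ℝ) (σ : ℝ≥0) (hσ : 0 < σ) (c₁ c₂ : ℝ) (hc₁ : 0 < c₁) (hc₂ : c₁ ≤ c₂) :
    ∃ K : ℝ, 0 < K ∧
      ∀ ν : ℕ → ℝ, ν =o[atTop] (fun D : ℕ => (D : ℝ) * Real.log D) →
      ∀ ε : ℝ, 0 < ε →
      ∃ δ : ℕ → ℝ, Tendsto δ atTop (𝓝 0) ∧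
        ∀ D : ℕ, 2 ≤ D →
        ∀ (V : Type*) [Fintype V] [DecidableEq V] [Nonempty V]
          (G : SimpleGraph V) [DecidableRel G.Adj],
          G.IsRegularOfDegree (D + 1) → G.CliqueFree 3 →
          Real.log (Fintype.card V) ≤ ν D →
        ∀ γ : ℝ, c₁ / Real.sqrt D ≤ |γ| → |γ| ≤ c₂ / Real.sqrt D →
          Integrable (QAOA.objective G γ) (QAOA.gaussianWeights G μ σ) ∧
          (QAOA.gaussianWeights G μ σ).real
              {w | ε * |∫ w', QAOA.objective G γ w' ∂(QAOA.gaussianWeights G μ σ)| ≤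
                |QAOA.objective G γ w -
                  ∫ w', QAOA.objective G γ w' ∂(QAOA.gaussianWeights G μ σ)|} ≤
            2 * Real.exp (-(ε * D * (1 - δ D)) / (K * Real.log D)) := by
  have hc₂pos : 0 < c₂ := hc₁.trans_le hc₂
  -- Fernique's theorem provides a Gaussian exponential moment; κ = C/2 is the only input about
  -- tails.
  obtain ⟨C, hC, hCint⟩ := IsGaussian.exists_integrable_exp_sq (gaussianReal μ (σ ^ 2))
  set κ := C / 2 with hκdef
  have hκ : 0 < κ := by positivity
  have hint : Integrable (fun x : ℝ => Real.exp (2 * κ * x ^ 2)) (gaussianReal μ (σ ^ 2)) := by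
    refine hCint.congr (ae_of_all _ fun x => ?_)
    simp only [Real.norm_eq_abs, sq_abs, hκdef]
    congr 1; ring
  obtain ⟨h1, h2, h4⟩ := QAOA.integrable_pow_of_exp_sq hκ hint
  obtain ⟨c, hc, hmean⟩ := QAOA.eventually_edge_mean_ge (c₂ := c₂) hc₁ h1 h2 h4
    (QAOA.integral_sq_gaussianReal_pos μ (pow_pos hσ 2))
  -- The bound exp(-Nη) with N > D is of smaller order than exp(-εD/(K log D)) for any fixed K > 0,
  -- so K = 1 will do.
  refine ⟨1, one_pos, fun ν _ ε hε => ?_⟩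
  -- The mean is N(D+1)/4 times a quantity of size at least c/√D, hence at least (c/4)N√D in
  -- absolute value.
  have hc4 : 0 < c / 4 := by positivity
  have hη := QAOA.deviationRate_pos (ρ := gaussianReal μ (σ ^ 2)) hκ hc₂pos hc4 hε
  set η := QAOA.deviationRate (gaussianReal μ (σ ^ 2)) κ c₂ (c / 4) ε with hηdef
  have hsmall := QAOA.eventually_mul_exp_neg_le (a := κ / c₂ ^ 2)
    (B := ∫ x, Real.exp (2 * κ * x ^ 2) ∂(gaussianReal μ (σ ^ 2)))
    (η := κ * ε * (c / 4) / (12 * c₂)) (by positivity) (by positivity)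
  obtain ⟨D₀, hD₀⟩ := eventually_atTop.1
    (hmean.and (hsmall.and (QAOA.eventually_three_mul_exp_le (ε := ε) hη)))
  -- Below the threshold `D₀` the value 1 makes the right side equal to 2, which bounds any
  -- probability; beyond it no correction is needed.
  refine ⟨fun D => if D₀ ≤ D then 0 else 1, ?_, ?_⟩
  · refine tendsto_const_nhds.congr' ?_
    filter_upwards [eventually_ge_atTop D₀] with D hD
    rw [if_pos hD]
  intro D hD V _ _ _ G _ hreg hG _ γ hγ1 hγ2
  refine ⟨QAOA.integrable_objective G hG γ h1, ?_⟩
  have hprob : IsProbabilityMeasure (QAOA.gaussianWeights G μ σ) := by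
    unfold QAOA.gaussianWeights; infer_instance
  by_cases hDD : D₀ ≤ D
  · obtain ⟨hm, hs, ht⟩ := hD₀ D hDD
    simp only [if_pos hDD, sub_zero, mul_one, one_mul]
    have hcard : (D : ℝ) ≤ Fintype.card V := by
      exact_mod_cast ((Nat.lt_succ_self D).trans (QAOA.lt_card_of_isRegularOfDegree G hreg)).le
    have hDpos : (0 : ℝ) < D := by exact_mod_cast (by omega : 0 < D)
    have hsD : 0 < Real.sqrt D := Real.sqrt_pos.2 hDpos
    have hEX : c / 4 * Fintype.card V * Real.sqrt D ≤
        |∫ w', QAOA.objective G γ w' ∂(QAOA.gaussianWeights G μ σ)| := by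
      have hval := QAOA.integral_objective (ρ := gaussianReal μ (σ ^ 2)) G hG γ h1 hreg
      unfold QAOA.gaussianWeights
      rw [hval, abs_mul, abs_of_nonneg (by positivity)]
      calc c / 4 * Fintype.card V * Real.sqrt D
          = Fintype.card V * D / 4 * (c / Real.sqrt D) := by
            have : (D : ℝ) = Real.sqrt D * Real.sqrt D := (Real.mul_self_sqrt hDpos.le).symm
            field_simp
            rw [Real.sq_sqrt hDpos.le]
        _ ≤ Fintype.card V * (D + 1) / 4 * (c / Real.sqrt D) := by gcongr; linarith
        _ ≤ _ := by gcongr; exact hm γ hγ1 hγ2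
    have hdev := QAOA.measureReal_objective_deviation_le (ρ := gaussianReal μ (σ ^ 2)) G hκ hc₂pos
      hc4 hε hint hD (by
        refine le_trans (le_of_eq ?_) hs
        congr 3; ring_nf) hG hreg hγ2
    refine le_trans ?_ ((hdev.trans ?_).trans ht)
    · refine measureReal_mono fun w hw => ?_
      simp only [Set.mem_ofPred_eq] at hw ⊢
      refine le_trans ?_ hw
      calc ε * (c / 4) * Fintype.card V * Real.sqrt D
          = ε * (c / 4 * Fintype.card V * Real.sqrt D) := by ring
        _ ≤ _ := by gcongr
    · gcongr
  · simp only [if_neg hDD, sub_self, mul_zero, neg_zero, zero_div, Real.exp_zero, mul_one]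
    exact measureReal_le_one.trans one_le_two
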